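/- Let $G_0=\mathrm{PSL}_2(\mathbb R)$ be the group of orientation-preserving isometries of the hyperbolic plane $\mathbb H^2$ (it is also the underlying set of the anti-de Sitter space $\mathrm{AdS}^3$). For a geodesic line $\ell$ of $\mathbb H^2$ with endpoints $\xi_1,\xi_2\in\partial_\infty\mathbb H^2$, let the left AdS crooked plane $\mathsf C(\ell)\subset G_0$ be the set consisting of the identity, the elliptic elements whose fixed point lies on $\ell$, the parabolic elements fixing $\xi_1$ or $\xi_2$, and the hyperbolic elements whose attracting fixed point is $\xi_1$ or $\xi_2$. A transverse orientation of $\ell$ is the choice of one of the two open half-planes bounded by $\ell$ as its positive side; given such a choice, let the stem quadrant $\mathsf{SQ}(\ell)\subset G_0$ be the set of hyperbolic elements whose axis is orthogonal to $\ell$ and that translate towards the positive side of $\ell$. Two disjoint transversely oriented geodesic lines are oriented away from each other if their positive sides are disjoint. **Theorem B.1.** Let $\ell,\ell'$ be geodesic lines of $\mathbb H^2$ and let $g,g'\in G_0$. Consider the following conditions: (A) the left AdS crooked planes $g\,\mathsf C(\ell)$ and $g'\,\mathsf C(\ell')$ are disjoint; (B) the geodesic lines $g\cdot\ell$ and $g'\cdot\ell'$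 are disjoint, and $g^{-1}g'\in\mathsf{SQ}(\ell)^{-1}\,\mathsf{SQ}(\ell')$ for the transverse orientations of $\ell$ and $\ell'$ that are taken by $g$ and $g'$ to the transverse orientations of $g\cdot\ell$ and $g'\cdot\ell'$ away from each other. Then (A) $\Rightarrow$ (B) always holds, and (B) $\Rightarrow$ (A) holds under the assumption that $\ell$ and $\ell'$ are disjoint and that they are oriented away from each other by the transverse orientations appearing in (B). -/

import Mathlib

open scoped Pointwise LinearAlgebra.Projectivization UpperHalfPlane

/-- The group `G₀ = PSL₂(ℝ)` of orientation-preserving isometries of the hyperbolic plane,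
which is also the underlying set of the anti-de Sitter space `AdS³`. -/
abbrev G₀ : Type := Matrix.ProjectiveSpecialLinearGroup (Fin 2) ℝ

/-- The ideal boundary `P¹(ℝ)` of the upper half-plane `ℍ`: the point `[v₀ : v₁]` is the
boundary point `v₀ / v₁`, which is `∞` if `v₁ = 0`. Mathlib provides the action of `G₀` on it. -/
abbrev IdealBoundary : Type := ℙ ℝ (Fin 2 → ℝ)

/-- `G₀` acts on the upper half-plane by Möbius transformations. -/
noncomputable instance G₀.instMulActionUpperHalfPlane : MulAction G₀ ℍ :=
  MulAction.compHom ℍ (Matrix.ProjectiveSpecialLinearGroup.toPGL (n := Fin 2) (R := ℝ))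

theorem G₀.mk_smul (A : Matrix.SpecialLinearGroup (Fin 2) ℝ) (z : ℍ) : (A : G₀) • z = A • z :=
  rfl

/-- A geodesic line of `ℍ`, given by its two (distinct) ideal endpoints. -/
structure GeodesicLine where
  /-- the first endpoint -/
  p : IdealBoundary
  /-- the second endpoint -/
  q : IdealBoundary
  /-- the endpoints are distinct -/
  ne : p ≠ q

namespace GeodesicLine

/-- The equation of a geodesic line with endpoints `[v]` and `[w]`: up to a nonzero factor, it is
`|z|² - (s + t) Re z + s t` if the endpoints are the real numbers `s = v₀ / v₁`, `t = w₀ / w₁`,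
and `Re z - s` if one endpoint is `s` and the other is `∞`. -/
noncomputable def eqn (l : GeodesicLine) (z : ℍ) : ℝ :=
  l.p.rep 1 * l.q.rep 1 * (z.re ^ 2 + z.im ^ 2)
    - (l.p.rep 0 * l.q.rep 1 + l.p.rep 1 * l.q.rep 0) * z.re + l.p.rep 0 * l.q.rep 0

/-- The set of points of a geodesic line: a half-circle centered on the real axis, or a vertical
half-line. -/
def carrier (l : GeodesicLine) : Set ℍ := {z | l.eqn z = 0}

/-- The Euclidean gradient at `z` of the equation of the line, with respect to the coordinates
`(Re z, Im z)`: a normal vector to the line at each of its points. -/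
noncomputable def normal (l : GeodesicLine) (z : ℍ) : ℝ × ℝ :=
  (2 * (l.p.rep 1 * l.q.rep 1) * z.re - (l.p.rep 0 * l.q.rep 1 + l.p.rep 1 * l.q.rep 0),
    2 * (l.p.rep 1 * l.q.rep 1) * z.im)

/-- Two geodesic lines meet orthogonally at the point `z`. (The hyperbolic metric is conformal to
the Euclidean one.) -/
def OrthogonalAt (l m : GeodesicLine) (z : ℍ) : Prop :=
  z ∈ l.carrier ∧ z ∈ m.carrier ∧
    (l.normal z).1 * (m.normal z).1 + (l.normal z).2 * (m.normal z).2 = 0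

/-- A transverse orientation of a geodesic line: the choice of one of the two open half-planes
bounded by the line, called its positive side. -/
structure TransverseOrientation (l : GeodesicLine) where
  /-- the positive side -/
  positiveSide : Set ℍ
  /-- the positive side is one of the two open half-planes bounded by the line -/
  isSide : positiveSide = {z | 0 < l.eqn z} ∨ positiveSide = {z | l.eqn z < 0}

end GeodesicLine

namespace G₀

/-- Elliptic isometries: represented by matrices of determinant one with `|trace| < 2`. -/
def IsElliptic (h : G₀) : Prop :=
  ∃ A : Matrix.SpecialLinearGroup (Fin 2) ℝ, (A : G₀) = h ∧ A.val.IsElliptic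

/-- Parabolic isometries: represented by non-scalar matrices of determinant one with
`|trace| = 2`. In particular the identity is not parabolic. -/
def IsParabolic (h : G₀) : Prop :=
  ∃ A : Matrix.SpecialLinearGroup (Fin 2) ℝ, (A : G₀) = h ∧ A.val.IsParabolic

/-- Hyperbolic isometries: represented by matrices of determinant one with `|trace| > 2`. -/
def IsHyperbolic (h : G₀) : Prop :=
  ∃ A : Matrix.SpecialLinearGroup (Fin 2) ℝ, (A : G₀) = h ∧ A.val.IsHyperbolic

/-- `h` is hyperbolic with attracting fixed point `ξ = [v]`: the vector `v` is an eigenvector, for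
an eigenvalue of absolute value greater than one, of a matrix of determinant one representing
`h`. -/
def HasAttractingPoint (h : G₀) (ξ : IdealBoundary) : Prop :=
  ∃ A : Matrix.SpecialLinearGroup (Fin 2) ℝ, (A : G₀) = h ∧
    ∃ c : ℝ, 1 < |c| ∧ A.val.mulVec ξ.rep = c • ξ.rep

/-- `m` is the translation axis of the hyperbolic isometry `h`. -/
def IsAxis (h : G₀) (m : GeodesicLine) : Prop :=
  h.IsHyperbolic ∧ h • m.p = m.p ∧ h • m.q = m.q

end G₀

namespace GeodesicLine

/-- The stem of the left crooked plane centered at the identity associated with `l`: its interior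
consists of the elliptic elements whose fixed point lies on `l`, and its boundary consists of the
identity and of the parabolic elements fixing an endpoint of `l`. -/
def stem (l : GeodesicLine) : Set G₀ :=
  {h | h.IsElliptic ∧ ∃ z ∈ l.carrier, h • z = z} ∪
    ({1} ∪ {h | h.IsParabolic ∧ (h • l.p = l.p ∨ h • l.q = l.q)})

/-- The wing associated with an ideal point: the hyperbolic elements attracting to that point. -/
def wing (ξ : IdealBoundary) : Set G₀ := {h | h.IsHyperbolic ∧ h.HasAttractingPoint ξ}

/-- The left `AdS` crooked plane `C(l)` centered at the identity associated with `l`. -/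
def leftCrookedPlane (l : GeodesicLine) : Set G₀ := l.stem ∪ (wing l.p ∪ wing l.q)

/-- The stem quadrant `SQ(l)` of the transversely oriented geodesic line `l`: the hyperbolic
elements whose axis is orthogonal to `l` and that translate towards the positive side of `l`. -/
def stemQuadrant (l : GeodesicLine) (o : l.TransverseOrientation) : Set G₀ :=
  {h | ∃ m : GeodesicLine, h.IsAxis m ∧ ∃ z : ℍ, l.OrthogonalAt m z ∧ h • z ∈ o.positiveSide}

end GeodesicLine

/-- The geodesic lines `g · l` and `g' · l'` are disjoint, and they are transversely oriented away
from each other (that is, their positive sides are disjoint) for the transverse orientations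
induced via `g` and `g'` by the transverse orientations `o` of `l` and `o'` of `l'`. -/
def DisjointAndOrientedAway (g g' : G₀) (l l' : GeodesicLine)
    (o : l.TransverseOrientation) (o' : l'.TransverseOrientation) : Prop :=
  Disjoint (g • l.carrier) (g' • l'.carrier) ∧ Disjoint (g • o.positiveSide) (g' • o'.positiveSide)

/-! Choose bases U and V of ℝ² formed by endpoint vectors of ℓ and ℓ', put H = g⁻¹g', and write V =
U W and H V = U W'. The pivot is a criterion on coordinates: C(ℓ) and H C(ℓ') are disjoint if and
only if |W i j| < |W' i j| for all i, j.

In the basis U the crooked plane becomes `CrookedCond` (`mem_leftCrookedPlane_iff`), so a common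
point is a pair of such matrices F, C of determinant one with F W = W' C. The inequalities exclude
this, by comparing entries or invariant definite forms (`CrookedCond.mul_ne_mul`). If one of them
fails, a common point can be written down (`abs_lt_abs_of_disjoint`).

Orientations enter through the model of ℍ as positive definite scalar products on ℝ² up to scale
(`gram`): the side of a line on which a point lies is the sign of the product of its two endpoint
vectors. For frames with suitable signs, lines oriented away from each other have coordinate
matrices with entries all of one sign (`same_sign_of_forall`), and H ∈ SQ(ℓ)⁻¹ SQ(ℓ') means W' = P W
Q with P, Q satisfying `StemQuadrantCond`.

For (A) ⇒ (B), the inequalities and det W = det W' yield disjoint lines; W' has entries of one sign,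
and W' = P W Q is solved explicitly (`exists_stemQuadrantCond_factorization`). For (B) ⇒ (A), the
extra hypothesis gives W entries of one sign, so that passing to P W Q increases every absolute
value (`abs_lt_abs_of_stemQuadrantCond`). -/

/-- The condition on the matrix of an isometry, with respect to a basis of eigenlines of a geodesic
line `l`, for the isometry to belong to the left crooked plane of `l`. -/
def CrookedCond (F : Matrix (Fin 2) (Fin 2) ℝ) : Prop :=
  (F 1 0 = 0 ∧ 1 ≤ |F 0 0|) ∨ (F 0 1 = 0 ∧ 1 ≤ |F 1 1|) ∨ (F 0 0 = F 1 1 ∧ |F 0 0| < 1)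

/-- The condition on the matrix of an isometry, with respect to a suitably oriented basis of
endpoints of a geodesic line, for the isometry to belong to the stem quadrant of the line. -/
def StemQuadrantCond (F : Matrix (Fin 2) (Fin 2) ℝ) : Prop :=
  F 0 0 = F 1 1 ∧ 0 < F 0 0 * F 0 1 ∧ 0 < F 0 0 * F 1 0

theorem StemQuadrantCond.neg {F : Matrix (Fin 2) (Fin 2) ℝ} (h : StemQuadrantCond F) :
    StemQuadrantCond (-F) := by
  simpa [StemQuadrantCond] using h

/-! ### Matrix algebra of the entrywise inequalities -/

theorem mul_ne_mul_of_sq_lt_sq {s t X X' : ℝ} (hs : 1 ≤ s ^ 2) (ht : t ^ 2 ≤ 1)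
    (h : X ^ 2 < X' ^ 2) : s * X' ≠ t * X := by
  intro e
  have e2 : s ^ 2 * X' ^ 2 = t ^ 2 * X ^ 2 := by rw [← mul_pow, ← mul_pow, e]
  have h1 := le_mul_of_one_le_left (sq_nonneg X') hs
  have h2 := mul_le_of_le_one_left (sq_nonneg X) ht
  linarith

theorem mul_form_ne_mul_form_of_sq_lt_sq {s t m n X Y X' Y' : ℝ} (hs : 1 ≤ s ^ 2) (ht : t ^ 2 ≤ 1)
    (hX : X ^ 2 < X' ^ 2) (hY : Y ^ 2 < Y' ^ 2) (hmn : m * n < 0) :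
    s ^ 2 * (m * X' ^ 2 - n * Y' ^ 2) ≠ t ^ 2 * (m * X ^ 2 - n * Y ^ 2) := by
  have pos : ∀ m n : ℝ, 0 < m → n < 0 →
      t ^ 2 * (m * X ^ 2 - n * Y ^ 2) < s ^ 2 * (m * X' ^ 2 - n * Y' ^ 2) := by
    intro m n hm hn
    have a := mul_lt_mul_of_pos_left hX hm
    have b := mul_lt_mul_of_neg_left hY hn
    have c : 0 ≤ m * X ^ 2 - n * Y ^ 2 := by
      have := mul_nonneg hm.le (sq_nonneg X)
      have := mul_nonneg (neg_nonneg.2 hn.le) (sq_nonneg Y)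
      linarith
    have h2 := mul_le_of_le_one_left c ht
    have h1 := le_mul_of_one_le_left (c.trans (by linarith : _ ≤ m * X' ^ 2 - n * Y' ^ 2)) hs
    linarith
  rcases mul_neg_iff.1 hmn with ⟨hm, hn⟩ | ⟨hm, hn⟩
  · exact (pos m n hm hn).ne'
  · intro e
    have := pos (-m) (-n) (neg_pos.2 hm) (neg_lt_zero.2 hn)
    linarith

/-- Crooked planes do not meet when the frame of the second one is moved away from that of the
first one. -/
theorem CrookedCond.mul_ne_mul {F C W W' : Matrix (Fin 2) (Fin 2) ℝ}
    (hF : CrookedCond F) (hC : CrookedCond C) (dF : F.det = 1) (dC : C.det = 1)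
    (hW : ∀ i j, |W i j| < |W' i j|) : F * W ≠ W' * C := by
  intro h
  have e := fun i j => congrFun (congrFun h i) j
  have e00 := e 0 0
  have e01 := e 0 1
  have e10 := e 1 0
  have e11 := e 1 1
  have w00 := sq_lt_sq.2 (hW 0 0)
  have w01 := sq_lt_sq.2 (hW 0 1)
  have w10 := sq_lt_sq.2 (hW 1 0)
  have w11 := sq_lt_sq.2 (hW 1 1)
  clear hW e h
  have one_le (t : ℝ) (ht : 1 ≤ |t|) : 1 ≤ t ^ 2 := by
    rw [← sq_abs]; exact one_le_pow₀ ht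
  have inv_le (s t : ℝ) (h : s * t = 1) (hs : 1 ≤ s ^ 2) : t ^ 2 ≤ 1 := by
    have : s ^ 2 * t ^ 2 = 1 := by rw [← mul_pow, h, one_pow]
    have := le_mul_of_one_le_left (sq_nonneg t) hs
    linarith
  have neg (x y z : ℝ) (h : x * x - y * z = 1) (hx : |x| < 1) : z * y < 0 := by
    have : x ^ 2 < 1 := (sq_lt_one_iff_abs_lt_one x).2 hx
    linarith
  simp only [Matrix.mul_apply, Fin.sum_univ_two, Matrix.det_fin_two, CrookedCond] at *
  generalize W 0 0 = a at *
  generalize W 0 1 = b at *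
  generalize W 1 0 = c at *
  generalize W 1 1 = d at *
  generalize W' 0 0 = a' at *
  generalize W' 0 1 = b' at *
  generalize W' 1 0 = c' at *
  generalize W' 1 1 = d' at *
  generalize F 0 0 = x at *
  generalize F 0 1 = y at *
  generalize F 1 0 = z at *
  generalize F 1 1 = w at *
  generalize C 0 0 = k at *
  generalize C 0 1 = l at *
  generalize C 1 0 = m at *
  generalize C 1 1 = n at *
  -- Two triangular matrices: compare one entry. One triangular, one elliptic: compare a row or
  -- column using the definite form preserved by the elliptic matrix, l X² - m Y² on rows for C and
  -- z X² - y Y² on columns for F.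
  rcases hF with ⟨rfl, hx⟩ | ⟨rfl, hw⟩ | ⟨rfl, hx⟩ <;>
    rcases hC with ⟨rfl, hk⟩ | ⟨rfl, hn⟩ | ⟨rfl, hk⟩
  · exact mul_ne_mul_of_sq_lt_sq (one_le _ hk) (inv_le x w (by linarith) (one_le _ hx)) w10
      (by linarith)
  · exact mul_ne_mul_of_sq_lt_sq (one_le _ hn) (inv_le x w (by linarith) (one_le _ hx)) w11
      (by linarith)
  · refine mul_form_ne_mul_form_of_sq_lt_sq (s := 1) (by norm_num)
      (inv_le x w (by linarith) (one_le _ hx)) w10 w11 (by linarith [neg _ _ _ dC hk] : l * m < 0) ?_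
    have e10' : w * c = c' * k + d' * m := by linarith
    have e11' : w * d = c' * l + d' * k := by linarith
    linear_combination (-l * (c' * k + d' * m + w * c)) * e10' +
      (m * (c' * l + d' * k + w * d)) * e11' - (l * c' ^ 2 - m * d' ^ 2) * dC
  · exact mul_ne_mul_of_sq_lt_sq (one_le _ hk) (inv_le w x (by linarith) (one_le _ hw)) w00
      (by linarith)
  · exact mul_ne_mul_of_sq_lt_sq (one_le _ hn) (inv_le w x (by linarith) (one_le _ hw)) w01
      (by linarith)
  · refine mul_form_ne_mul_form_of_sq_lt_sq (s := 1) (by norm_num)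
      (inv_le w x (by linarith) (one_le _ hw)) w00 w01 (by linarith [neg _ _ _ dC hk] : l * m < 0) ?_
    have e00' : x * a = a' * k + b' * m := by linarith
    have e01' : x * b = a' * l + b' * k := by linarith
    linear_combination (-l * (a' * k + b' * m + x * a)) * e00' +
      (m * (a' * l + b' * k + x * b)) * e01' - (l * a' ^ 2 - m * b' ^ 2) * dC
  · refine mul_form_ne_mul_form_of_sq_lt_sq (t := 1) (one_le _ hk) (by norm_num) w00 w10
      (neg _ _ _ dF hx) ?_
    have e00' : x * a + y * c = a' * k := by linarith
    have e10' : z * a + x * c = c' * k := by linarith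
    linear_combination (-z * (x * a + y * c + a' * k)) * e00' +
      (y * (z * a + x * c + c' * k)) * e10' + (z * a ^ 2 - y * c ^ 2) * dF
  · refine mul_form_ne_mul_form_of_sq_lt_sq (t := 1) (one_le _ hn) (by norm_num) w01 w11
      (neg _ _ _ dF hx) ?_
    have e01' : x * b + y * d = b' * n := by linarith
    have e11' : z * b + x * d = d' * n := by linarith
    linear_combination (-z * (x * b + y * d + b' * n)) * e01' +
      (y * (z * b + x * d + d' * n)) * e11' + (z * b ^ 2 - y * d ^ 2) * dF
  · have hzy := neg _ _ _ dF hx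
    have hml := neg _ _ _ dC hk
    -- Two elliptic matrices: the tensor product of the two invariant forms is a form on matrices,
    -- unchanged by W ↦ F W and W' ↦ W' C. Its four coefficients have the same sign, so it is
    -- strictly monotone in the squares of the entries.
    have E : z * (l * a' ^ 2 - m * b' ^ 2) - y * (l * c' ^ 2 - m * d' ^ 2) =
        z * (l * a ^ 2 - m * b ^ 2) - y * (l * c ^ 2 - m * d ^ 2) := by
      have r1 : ∀ p q : ℝ, l * (p * k + q * m) ^ 2 - m * (p * l + q * k) ^ 2 =
          l * p ^ 2 - m * q ^ 2 := fun p q => by linear_combination (l * p ^ 2 - m * q ^ 2) * dC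
      have r2 : ∀ p q : ℝ, z * (x * p + y * q) ^ 2 - y * (z * p + x * q) ^ 2 =
          z * p ^ 2 - y * q ^ 2 := fun p q => by linear_combination (z * p ^ 2 - y * q ^ 2) * dF
      have s1 := r1 a' b'
      have s2 := r1 c' d'
      have s3 := r2 a c
      have s4 := r2 b d
      rw [← e00, ← e01] at s1
      rw [← e10, ← e11] at s2
      linear_combination -z * s1 + y * s2 + l * s3 - m * s4
    have pos : ∀ y z l m : ℝ, y < 0 → 0 < z → 0 < l → m < 0 →
        z * (l * a ^ 2 - m * b ^ 2) - y * (l * c ^ 2 - m * d ^ 2) <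
        z * (l * a' ^ 2 - m * b' ^ 2) - y * (l * c' ^ 2 - m * d' ^ 2) := by
      intro y z l m hy hz hl hm
      have h1 := mul_lt_mul_of_pos_left (add_lt_add (mul_lt_mul_of_pos_left w00 hl)
        (mul_lt_mul_of_pos_left w01 (neg_pos.2 hm))) hz
      have h2 := mul_lt_mul_of_pos_left (add_lt_add (mul_lt_mul_of_pos_left w10 hl)
        (mul_lt_mul_of_pos_left w11 (neg_pos.2 hm))) (neg_pos.2 hy)
      linarith
    rcases mul_neg_iff.1 hzy with ⟨h1, h2⟩ | ⟨h1, h2⟩ <;>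
      rcases mul_neg_iff.1 hml with ⟨h3, h4⟩ | ⟨h3, h4⟩
    · have := pos y z (-l) (-m) h2 h1 (neg_pos.2 h4) (neg_lt_zero.2 h3)
      linarith
    · have := pos y z l m h2 h1 h4 h3
      linarith
    · have := pos (-y) (-z) (-l) (-m) (neg_lt_zero.2 h2) (neg_pos.2 h1) (neg_pos.2 h4)
        (neg_lt_zero.2 h3)
      linarith
    · have := pos (-y) (-z) l m (neg_lt_zero.2 h2) (neg_pos.2 h1) h4 h3
      linarith

theorem eq_zero_of_mul_self_le {S A B : ℝ} (hA : 0 ≤ A) (hB : 0 ≤ B) (h : 0 < S - A)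
    (hS : S * S ≤ (S - A) * (S - B)) : A = 0 := by
  have h1 := mul_nonneg h.le hB
  have h2 : A * S ≤ 0 := by linarith
  exact le_antisymm (nonpos_of_mul_nonpos_left h2 (by linarith)) hA

/-- Normalizing P and Q to have the same diagonal κ turns P⁻¹ W' = W Q into four linear equations in
the off-diagonal ratios. Their solution is positive; the only obstruction is det P = 1, which needs
q r < 1. This holds for W or for -W, and the sign can be absorbed in P. -/
theorem exists_stemQuadrantCond_factorization {W W' : Matrix (Fin 2) (Fin 2) ℝ}
    (hd : W.det = W'.det) (h0 : W.det ≠ 0) (hW : ∀ i j, |W i j| < |W' i j|)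
    (hpos : ∀ i j, 0 < W' i j) :
    ∃ P Q : Matrix (Fin 2) (Fin 2) ℝ, P.det = 1 ∧ Q.det = 1 ∧ StemQuadrantCond P ∧
      StemQuadrantCond Q ∧ W' = P * W * Q := by
  -- the case where a certain inequality holds, which is true up to replacing `W` with `-W`
  have key : ∀ V : Matrix (Fin 2) (Fin 2) ℝ, V.det = W'.det → (∀ i j, |V i j| < |W' i j|) →
      (W' 0 0 - V 0 0) * (W' 1 1 - V 1 1) * ((W' 0 1 - V 0 1) * (W' 1 0 - V 1 0)) <
        (W' 0 0 * W' 1 1 - V 0 0 * V 1 1) ^ 2 →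
      ∃ P Q : Matrix (Fin 2) (Fin 2) ℝ, P.det = 1 ∧ Q.det = 1 ∧ StemQuadrantCond P ∧
      StemQuadrantCond Q ∧ W' = P * V * Q := by
    intro V hd hV hlt
    have lt : ∀ i j, 0 < W' i j - V i j := fun i j => by
      have := (abs_lt.1 (abs_of_pos (hpos i j) ▸ hV i j)).2
      linarith
    have N1 : 0 < W' 0 0 * W' 1 1 - V 0 0 * V 1 1 := by
      have : |V 0 0 * V 1 1| < W' 0 0 * W' 1 1 := by
        rw [abs_mul]
        exact mul_lt_mul'' (abs_of_pos (hpos 0 0) ▸ hV 0 0) (abs_of_pos (hpos 1 1) ▸ hV 1 1)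
          (abs_nonneg _) (abs_nonneg _)
      linarith [(abs_lt.1 this).2]
    have A := lt 0 0
    have B := lt 0 1
    have C := lt 1 0
    have D := lt 1 1
    simp only [Matrix.det_fin_two] at hd
    obtain ⟨N, hN⟩ : ∃ N, N = W' 0 0 * W' 1 1 - V 0 0 * V 1 1 := ⟨_, rfl⟩
    have hN2 : N = W' 0 1 * W' 1 0 - V 0 1 * V 1 0 := by linarith
    rw [← hN] at N1 hlt
    -- Solution of the linear system `E00`–`E11` for P = κ (1, q; r, 1) and Q = κ (1, t; v, 1).
    -- Equality of the determinants gives the two expressions of N.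
    obtain ⟨q, hq⟩ : ∃ q, q = (W' 0 0 - V 0 0) * (W' 0 1 - V 0 1) / N := ⟨_, rfl⟩
    obtain ⟨r, hr⟩ : ∃ r, r = (W' 1 0 - V 1 0) * (W' 1 1 - V 1 1) / N := ⟨_, rfl⟩
    obtain ⟨v, hv⟩ : ∃ v, v = (W' 0 0 - V 0 0) * (W' 1 0 - V 1 0) / N := ⟨_, rfl⟩
    obtain ⟨t, ht⟩ : ∃ t, t = (W' 0 1 - V 0 1) * (W' 1 1 - V 1 1) / N := ⟨_, rfl⟩
    have q0 : 0 < q := by rw [hq]; positivity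
    have r0 : 0 < r := by rw [hr]; positivity
    have v0 : 0 < v := by rw [hv]; positivity
    have t0 : 0 < t := by rw [ht]; positivity
    have hqr : q * r < 1 := by
      rw [hq, hr, div_mul_div_comm, div_lt_one (by positivity)]
      linarith
    have htv : t * v = q * r := by
      rw [hq, hr, hv, ht]; field_simp
    have N0 := N1.ne'
    have E00 : W' 0 0 - q * W' 1 0 = V 0 0 + V 0 1 * v := by
      rw [hq, hv]; field_simp; rw [hN2]; ring
    have E01 : W' 0 1 - q * W' 1 1 = V 0 0 * t + V 0 1 := by
      rw [hq, ht]; field_simp; rw [hN]; ring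
    have E10 : W' 1 0 - r * W' 0 0 = V 1 0 + V 1 1 * v := by
      rw [hr, hv]; field_simp; rw [hN]; ring
    have E11 : W' 1 1 - r * W' 0 1 = V 1 0 * t + V 1 1 := by
      rw [hr, ht]; field_simp; rw [hN2]; ring
    obtain ⟨κ, κ0, hκ⟩ : ∃ κ : ℝ, 0 < κ ∧ κ ^ 2 * (1 - q * r) = 1 := by
      have : 0 < 1 - q * r := by linarith
      refine ⟨(√(1 - q * r))⁻¹, by positivity, ?_⟩
      rw [inv_pow, Real.sq_sqrt this.le, inv_mul_cancel₀ this.ne']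
    refine ⟨!![κ, κ * q; κ * r, κ], !![κ, κ * t; κ * v, κ], ?_, ?_, ?_, ?_, ?_⟩
    · rw [Matrix.det_fin_two_of]; linarith
    · rw [Matrix.det_fin_two_of]; linear_combination hκ - κ ^ 2 * htv
    · refine ⟨rfl, ?_, ?_⟩ <;> simp <;> positivity
    · refine ⟨rfl, ?_, ?_⟩ <;> simp <;> positivity
    · ext i j
      fin_cases i <;> fin_cases j <;>
        simp [Matrix.mul_apply, Fin.sum_univ_two, Matrix.vecMul, dotProduct]
      · linear_combination κ ^ 2 * E00 + κ ^ 2 * q * E10 - W' 0 0 * hκ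
      · linear_combination κ ^ 2 * E01 + κ ^ 2 * q * E11 - W' 0 1 * hκ
      · linear_combination κ ^ 2 * E10 + κ ^ 2 * r * E00 - W' 1 0 * hκ
      · linear_combination κ ^ 2 * E11 + κ ^ 2 * r * E01 - W' 1 1 * hκ
  by_cases h1 : (W' 0 0 - W 0 0) * (W' 1 1 - W 1 1) * ((W' 0 1 - W 0 1) * (W' 1 0 - W 1 0)) <
        (W' 0 0 * W' 1 1 - W 0 0 * W 1 1) ^ 2
  · exact key W hd hW h1
  obtain ⟨P, Q, hP, hQ, sP, sQ, e⟩ := key (-W) (by simpa [Matrix.det_fin_two] using hd)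
    (by simpa using hW) (by
    -- If the inequality failed for both W and -W, multiplying the failures would give N⁴ ≤ (N² -
    -- α²)(N² - β²), with α = a' d - a d' and β = b' c - b c'. Hence α = β = 0.
    by_contra! h2
    rw [not_lt] at h1
    simp only [Matrix.neg_apply] at h2
    have w := fun i j => abs_of_pos (hpos i j) ▸ hW i j
    have w00 := hpos 0 0
    have w01 := hpos 0 1
    have w10 := hpos 1 0
    have w11 := hpos 1 1
    have v00 := abs_lt.1 (w 0 0)
    have v01 := abs_lt.1 (w 0 1)
    have v10 := abs_lt.1 (w 1 0)
    have v11 := abs_lt.1 (w 1 1)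
    simp only [Matrix.det_fin_two] at hd h0
    clear w key hpos hW
    generalize W 0 0 = a at *
    generalize W 0 1 = b at *
    generalize W 1 0 = c at *
    generalize W 1 1 = d at *
    generalize W' 0 0 = a' at *
    generalize W' 0 1 = b' at *
    generalize W' 1 0 = c' at *
    generalize W' 1 1 = d' at *
    obtain ⟨N, hN⟩ : ∃ N, N = a' * d' - a * d := ⟨_, rfl⟩
    have hN2 : N = b' * c' - b * c := by linarith
    have e1 : -a * -d = a * d := by ring
    rw [← hN] at h1
    rw [e1, ← hN] at h2
    have h3 := mul_le_mul h1 h2 (sq_nonneg N) ((sq_nonneg N).trans h1)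
    have p1 : 0 < (a' ^ 2 - a ^ 2) * (d' ^ 2 - d ^ 2) := mul_pos (by nlinarith) (by nlinarith)
    have p2 : 0 < (b' ^ 2 - b ^ 2) * (c' ^ 2 - c ^ 2) := mul_pos (by nlinarith) (by nlinarith)
    have q1 : (a' ^ 2 - a ^ 2) * (d' ^ 2 - d ^ 2) = N ^ 2 - (a' * d - a * d') ^ 2 := by
      rw [hN]; ring
    have q2 : (b' ^ 2 - b ^ 2) * (c' ^ 2 - c ^ 2) = N ^ 2 - (b' * c - b * c') ^ 2 := by
      rw [hN2]; ring
    have h4 : N ^ 2 * N ^ 2 ≤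
        (N ^ 2 - (a' * d - a * d') ^ 2) * (N ^ 2 - (b' * c - b * c') ^ 2) := by
      rw [← q1, ← q2]; linarith
    rw [q1] at p1
    rw [q2] at p2
    have z1 := eq_zero_of_mul_self_le (sq_nonneg _) (sq_nonneg _) p1 h4
    have z2 := eq_zero_of_mul_self_le (sq_nonneg _) (sq_nonneg _) p2 (h4.trans_eq (mul_comm _ _))
    have y1 := pow_eq_zero_iff two_ne_zero |>.1 z1
    have y2 := pow_eq_zero_iff two_ne_zero |>.1 z2
    -- The diagonal of W is now x times that of W', and the antidiagonal y times. The two failures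
    -- then force y = -x, and equality of the determinants makes both vanish.
    obtain ⟨x, rfl⟩ : ∃ x, a = x * a' := ⟨a / a', by field_simp⟩
    obtain ⟨y, rfl⟩ : ∃ y, b = y * b' := ⟨b / b', by field_simp⟩
    obtain rfl : d = x * d' := mul_left_cancel₀ w00.ne' (by linarith)
    obtain rfl : c = y * c' := mul_left_cancel₀ w01.ne' (by linarith)
    have f1 : N ^ 2 = a' * d' * (b' * c') * ((1 - x ^ 2) * (1 - y ^ 2)) := by
      rw [sq]; nth_rw 1 [hN]; rw [hN2]; ring
    have g : 0 < a' * d' * (b' * c') := by positivity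
    have g1 : (1 - x ^ 2) * (1 - y ^ 2) ≤ (1 - x) ^ 2 * (1 - y) ^ 2 := by
      refine le_of_mul_le_mul_left ?_ g
      rw [← f1]; linarith
    have g2 : (1 - x ^ 2) * (1 - y ^ 2) ≤ (1 + x) ^ 2 * (1 + y) ^ 2 := by
      refine le_of_mul_le_mul_left ?_ g
      rw [← f1]; linarith
    have x1 : x < 1 := lt_of_mul_lt_mul_right (by linarith) w00.le
    have x2 : -1 < x := lt_of_mul_lt_mul_right (by linarith) w00.le
    have y1 : y < 1 := lt_of_mul_lt_mul_right (by linarith) w01.le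
    have y2 : -1 < y := lt_of_mul_lt_mul_right (by linarith) w01.le
    have k1 : (1 + x) * (1 + y) ≤ (1 - x) * (1 - y) := by
      refine le_of_mul_le_mul_left ?_ (mul_pos (sub_pos.2 x1) (sub_pos.2 y1))
      linarith
    have k2 : (1 - x) * (1 - y) ≤ (1 + x) * (1 + y) := by
      refine le_of_mul_le_mul_left ?_ (mul_pos (by linarith : 0 < 1 + x) (by linarith : 0 < 1 + y))
      linarith
    obtain rfl : y = -x := by linarith
    have k3 : (1 - x ^ 2) * (a' * d' - b' * c') = 0 := by linarith
    have k4 : 0 < 1 - x ^ 2 := by linarith [mul_pos (sub_pos.2 x1) (by linarith : 0 < 1 + x)]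
    have k5 := (mul_eq_zero.1 k3).resolve_left k4.ne'
    exact h0 (by linear_combination x ^ 2 * k5))
  exact ⟨-P, Q, by simpa [Matrix.det_fin_two] using hP, hQ, sP.neg, sQ, by simpa using e⟩

/-- Up to sign, P and Q have positive entries and diagonals greater than one. An entry of P W Q is
thus the same entry of W with a coefficient above one, plus positive multiples of the others;
invertibility of W makes this strict even at a zero entry. -/
theorem abs_lt_abs_of_stemQuadrantCond {P Q W : Matrix (Fin 2) (Fin 2) ℝ}
    (hP : StemQuadrantCond P) (hQ : StemQuadrantCond Q) (dP : P.det = 1) (dQ : Q.det = 1)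
    (h0 : W.det ≠ 0) (hW : (∀ i j, 0 ≤ W i j) ∨ ∀ i j, W i j ≤ 0) (i j : Fin 2) :
    |W i j| < |(P * W * Q) i j| := by
  have nonneg : ∀ P Q W : Matrix (Fin 2) (Fin 2) ℝ, StemQuadrantCond P → StemQuadrantCond Q →
      P.det = 1 → Q.det = 1 → W.det ≠ 0 → (∀ i j, 0 ≤ W i j) → 0 < P 0 0 → 0 < Q 0 0 →
      |W i j| < |(P * W * Q) i j| := by
    intro P Q W ⟨P1, P2, P3⟩ ⟨Q1, Q2, Q3⟩ dP dQ h0 hW hP hQ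
    rw [abs_of_nonneg (hW i j)]
    refine lt_of_lt_of_le ?_ (le_abs_self _)
    have P2 := (mul_pos_iff_of_pos_left hP).1 P2
    have P3 := (mul_pos_iff_of_pos_left hP).1 P3
    have Q2 := (mul_pos_iff_of_pos_left hQ).1 Q2
    have Q3 := (mul_pos_iff_of_pos_left hQ).1 Q3
    have a0 := hW 0 0
    have b0 := hW 0 1
    have c0 := hW 1 0
    have d0 := hW 1 1
    simp only [Matrix.det_fin_two, ← P1, ← Q1] at dP dQ h0
    have P4 : 1 < P 0 0 := by nlinarith [mul_pos P2 P3]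
    have Q4 : 1 < Q 0 0 := by nlinarith [mul_pos Q2 Q3]
    have aux : ∀ k₁ k₂ k₃ k₄ a b c d : ℝ, 1 < k₁ → 0 < k₂ → 0 < k₃ → 0 < k₄ → 0 ≤ a → 0 ≤ b →
        0 ≤ c → 0 ≤ d → a * d - b * c ≠ 0 → a < k₁ * a + k₂ * b + k₃ * c + k₄ * d := by
      intro k₁ k₂ k₃ k₄ a b c d h₁ h₂ h₃ h₄ ha hb hc hd h
      have := mul_nonneg h₂.le hb
      have := mul_nonneg h₃.le hc
      have := mul_nonneg h₄.le hd
      rcases ha.eq_or_lt with rfl | ha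
      · have : 0 < b := hb.lt_of_ne' fun h' => h (by rw [h']; ring)
        have := mul_pos h₂ this
        linarith
      · have := mul_lt_mul_of_pos_right h₁ ha
        linarith
    have PQ : 1 < P 0 0 * Q 0 0 := by nlinarith
    fin_cases i <;> fin_cases j <;>
      simp only [Matrix.mul_apply, Fin.sum_univ_two, ← P1, ← Q1, Fin.zero_eta, Fin.mk_one,
        Fin.isValue]
    · linarith [aux (P 0 0 * Q 0 0) (P 0 0 * Q 1 0) (P 0 1 * Q 0 0) (P 0 1 * Q 1 0) _ _ _ _ PQ
        (by positivity) (by positivity) (by positivity) a0 b0 c0 d0 h0]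
    · linarith [aux (P 0 0 * Q 0 0) (P 0 0 * Q 0 1) (P 0 1 * Q 0 0) (P 0 1 * Q 0 1) _ _ _ _ PQ
        (by positivity) (by positivity) (by positivity) b0 a0 d0 c0
        (fun h => h0 (by linarith))]
    · linarith [aux (P 0 0 * Q 0 0) (P 0 0 * Q 1 0) (P 1 0 * Q 0 0) (P 1 0 * Q 1 0) _ _ _ _ PQ
        (by positivity) (by positivity) (by positivity) c0 d0 a0 b0
        (fun h => h0 (by linarith))]
    · linarith [aux (P 0 0 * Q 0 0) (P 0 0 * Q 0 1) (P 1 0 * Q 0 0) (P 1 0 * Q 0 1) _ _ _ _ PQ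
        (by positivity) (by positivity) (by positivity) d0 c0 b0 a0
        (fun h => h0 (by linarith))]
  have aux : ∀ W : Matrix (Fin 2) (Fin 2) ℝ, W.det ≠ 0 → (∀ i j, 0 ≤ W i j) →
      |W i j| < |(P * W * Q) i j| := by
    intro W h0 hW
    have nP : P 0 0 ≠ 0 := left_ne_zero_of_mul hP.2.1.ne'
    have nQ : Q 0 0 ≠ 0 := left_ne_zero_of_mul hQ.2.1.ne'
    have dP' : (-P).det = 1 := by simpa [Matrix.det_fin_two] using dP
    have dQ' : (-Q).det = 1 := by simpa [Matrix.det_fin_two] using dQ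
    rcases nP.lt_or_gt with p | p <;> rcases nQ.lt_or_gt with q | q
    · simpa using nonneg (-P) (-Q) W hP.neg hQ.neg dP' dQ' h0 hW (by simpa) (by simpa)
    · simpa using nonneg (-P) Q W hP.neg hQ dP' dQ h0 hW (by simpa) q
    · simpa using nonneg P (-Q) W hP hQ.neg dP dQ' h0 hW p (by simpa)
    · exact nonneg P Q W hP hQ dP dQ h0 hW p q
  rcases hW with hW | hW
  · exact aux W h0 hW
  · simpa using aux (-W) (by simpa [Matrix.det_fin_two] using h0) (by simpa using hW)

/-- If the two products in det W' had opposite signs, their absolute values would add up, making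
|det W'| larger than |det W|. -/
theorem mul_pos_of_abs_lt_abs {W W' : Matrix (Fin 2) (Fin 2) ℝ} (hd : W.det = W'.det)
    (hW : ∀ i j, |W i j| < |W' i j|) : 0 < W' 0 0 * W' 1 1 * (W' 0 1 * W' 1 0) := by
  have h1 : |W 0 0 * W 1 1| < |W' 0 0 * W' 1 1| := by
    rw [abs_mul, abs_mul]
    exact mul_lt_mul'' (hW 0 0) (hW 1 1) (abs_nonneg _) (abs_nonneg _)
  have h2 : |W 0 1 * W 1 0| < |W' 0 1 * W' 1 0| := by
    rw [abs_mul, abs_mul]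
    exact mul_lt_mul'' (hW 0 1) (hW 1 0) (abs_nonneg _) (abs_nonneg _)
  simp only [Matrix.det_fin_two] at hd
  have n1 : W' 0 0 * W' 1 1 ≠ 0 := abs_pos.1 ((abs_nonneg _).trans_lt h1)
  have n2 : W' 0 1 * W' 1 0 ≠ 0 := abs_pos.1 ((abs_nonneg _).trans_lt h2)
  have l1 := abs_le.1 (le_refl |W 0 0 * W 1 1|)
  have l2 := abs_le.1 (le_refl |W 0 1 * W 1 0|)
  rcases n1.lt_or_gt with m1 | m1 <;> rcases n2.lt_or_gt with m2 | m2
  · exact mul_pos_of_neg_of_neg m1 m2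
  · rw [abs_of_neg m1] at h1; rw [abs_of_pos m2] at h2; linarith
  · rw [abs_of_pos m1] at h1; rw [abs_of_neg m2] at h2; linarith
  · exact mul_pos m1 m2

/-! ### Sign patterns from linear inequalities -/

/-- On A C = 1 the infimum of m A + n C is 2√(m n). The parameter ε keeps the near-optimal choice
defined when m or n vanishes, and makes A C exceed one. -/
theorem exists_add_lt_of_lt_sq {m n S : ℝ} (hm : 0 ≤ m) (hn : 0 ≤ n) (hS : 0 < S)
    (h : 4 * (m * n) < S ^ 2) : ∃ A C : ℝ, 0 < A ∧ 0 < C ∧ 1 < A * C ∧ m * A + n * C < S := by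
  obtain ⟨ε, e0, e1, e2⟩ : ∃ ε : ℝ, 0 < ε ∧ ε ≤ 1 ∧ 4 * ε * (m + n + 1) < S ^ 2 - 4 * (m * n) := by
    have hp : 0 < m + n + 1 := by linarith
    have hq : 0 < S ^ 2 - 4 * (m * n) := by linarith
    refine ⟨min 1 ((S ^ 2 - 4 * (m * n)) / (8 * (m + n + 1))), by positivity, min_le_left _ _, ?_⟩
    have := min_le_right 1 ((S ^ 2 - 4 * (m * n)) / (8 * (m + n + 1)))
    rw [le_div_iff₀ (by positivity)] at this
    linarith
  refine ⟨S / (2 * (m + ε)), S / (2 * (n + ε)), by positivity, by positivity, ?_, ?_⟩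
  · rw [div_mul_div_comm, one_lt_div (by positivity)]
    nlinarith
  · have h1 : m * (S / (2 * (m + ε))) < S / 2 := by
      rw [← mul_div_assoc, div_lt_iff₀ (by positivity)]; nlinarith [mul_pos hS e0]
    have h2 : n * (S / (2 * (n + ε))) < S / 2 := by
      rw [← mul_div_assoc, div_lt_iff₀ (by positivity)]; nlinarith [mul_pos hS e0]
    linarith

theorem nonneg_of_forall_linear {m n S : ℝ}
    (h : ∀ A C : ℝ, 0 < A → 0 < C → 1 < A * C → 0 ≤ m * A + S + n * C) : 0 ≤ m := by
  by_contra! hm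
  have := h ((|S| + |n| + 1) / -m + 2) 1 (by have : 0 < -m := by linarith
                                             positivity) one_pos (by
    have : 0 < (|S| + |n| + 1) / -m := by
      have : 0 < -m := by linarith
      positivity
    linarith)
  have e : m * ((|S| + |n| + 1) / -m) = -(|S| + |n| + 1) := by
    rw [div_neg, mul_neg, mul_div_cancel₀ _ hm.ne]
  have := le_abs_self S
  have := le_abs_self n
  nlinarith

/-- If no scalar product that is positive on the first basis is negative on the second one, the
coordinates of the second basis in the first one all have the same sign. -/
theorem same_sign_of_forall {W : Matrix (Fin 2) (Fin 2) ℝ} (h0 : W.det ≠ 0)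
    (h : ∀ A C : ℝ, 0 < A → 0 < C → 1 < A * C →
      0 ≤ W 0 0 * W 0 1 * A + (W 0 0 * W 1 1 + W 0 1 * W 1 0) + W 1 0 * W 1 1 * C) :
    (∀ i j, 0 ≤ W i j) ∨ ∀ i j, W i j ≤ 0 := by
  have m0 := nonneg_of_forall_linear h
  have n0 : 0 ≤ W 1 0 * W 1 1 :=
    nonneg_of_forall_linear (n := W 0 0 * W 0 1) (S := W 0 0 * W 1 1 + W 0 1 * W 1 0)
      fun A C hA hC hAC => by linarith [h C A hC hA (by linarith)]
  have s0 : 0 ≤ W 0 0 * W 1 1 + W 0 1 * W 1 0 := by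
    by_contra! hs
    rw [Matrix.det_fin_two] at h0
    -- The discriminant condition holds because (ad + bc)² - 4 (ab)(cd) = (ad - bc)² > 0.
    obtain ⟨A, C, hA, hC, hAC, hlt⟩ := exists_add_lt_of_lt_sq m0 n0 (neg_pos.2 hs) (by
      have := sq_pos_of_ne_zero h0
      linarith)
    linarith [h A C hA hC hAC]
  rw [Matrix.det_fin_two] at h0
  simp only [Fin.forall_fin_two]
  clear h
  generalize W 0 0 = a at *
  generalize W 0 1 = b at *
  generalize W 1 0 = c at *
  generalize W 1 1 = d at *
  have prod : a * d * (b * c) = a * b * (c * d) := by ring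
  have hprod : 0 ≤ a * d * (b * c) := prod ▸ mul_nonneg m0 n0
  have ad : 0 ≤ a * d := by
    by_contra! h
    have := mul_neg_of_neg_of_pos h (by linarith : 0 < b * c)
    linarith
  have bc : 0 ≤ b * c := by
    by_contra! h
    have := mul_neg_of_pos_of_neg (by linarith : 0 < a * d) h
    linarith
  rcases lt_trichotomy a 0 with ha | rfl | ha
  · have hb : b ≤ 0 := nonpos_of_mul_nonneg_right m0 ha
    have hd : d ≤ 0 := nonpos_of_mul_nonneg_right ad ha
    refine Or.inr ⟨⟨ha.le, hb⟩, ?_, hd⟩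
    by_contra! hc
    have hd' : d = 0 := le_antisymm hd ((mul_nonneg_iff_of_pos_left hc).1 n0)
    have hb' : b = 0 := le_antisymm hb ((mul_nonneg_iff_of_pos_right hc).1 bc)
    exact h0 (by rw [hd', hb']; ring)
  · have hbc : 0 < b * c := bc.lt_of_ne' fun h => h0 (by rw [h]; ring)
    rcases mul_pos_iff.1 hbc with ⟨hb, hc⟩ | ⟨hb, hc⟩
    · exact Or.inl ⟨⟨le_rfl, hb.le⟩, hc.le, (mul_nonneg_iff_of_pos_left hc).1 n0⟩
    · exact Or.inr ⟨⟨le_rfl, hb.le⟩, hc.le, nonpos_of_mul_nonneg_right n0 hc⟩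
  · have hb : 0 ≤ b := (mul_nonneg_iff_of_pos_left ha).1 m0
    have hd : 0 ≤ d := (mul_nonneg_iff_of_pos_left ha).1 ad
    refine Or.inl ⟨⟨ha.le, hb⟩, ?_, hd⟩
    by_contra! hc
    have hd' : d = 0 := le_antisymm (nonpos_of_mul_nonneg_right n0 hc) hd
    have hb' : b = 0 := le_antisymm (nonpos_of_mul_nonneg_left bc hc) hb
    exact h0 (by rw [hd', hb']; ring)

/-! ### Points of ℍ as scalar products on ℝ² up to scale -/

open Matrix in
/-- The Gram matrix of a pair of vectors of `ℝ²`, the columns of `U`, for the scalar product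
associated with the point `z` of the upper half-plane. -/
noncomputable def gram (z : ℍ) (U : Matrix (Fin 2) (Fin 2) ℝ) : Matrix (Fin 2) (Fin 2) ℝ :=
  Uᵀ * !![1, -z.re; -z.re, z.re ^ 2 + z.im ^ 2] * U

theorem gram_apply (z : ℍ) (U : Matrix (Fin 2) (Fin 2) ℝ) (i j : Fin 2) :
    gram z U i j = U 0 i * U 0 j - (U 0 i * U 1 j + U 1 i * U 0 j) * z.re +
      U 1 i * U 1 j * (z.re ^ 2 + z.im ^ 2) := by
  simp [gram, Matrix.mul_apply, Fin.sum_univ_two]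
  ring

open Matrix in
theorem gram_mul (z : ℍ) (U F : Matrix (Fin 2) (Fin 2) ℝ) :
    _root_.gram z (U * F) = Fᵀ * _root_.gram z U * F := by
  simp only [_root_.gram, transpose_mul, Matrix.mul_assoc]

theorem gram_symm (z : ℍ) (U : Matrix (Fin 2) (Fin 2) ℝ) : gram z U 1 0 = gram z U 0 1 := by
  simp only [gram_apply]; ring

theorem gram_mul_apply (z : ℍ) (U F : Matrix (Fin 2) (Fin 2) ℝ) (i j : Fin 2) :
    gram z (U * F) i j = gram z U 0 0 * (F 0 i * F 0 j) +
      gram z U 0 1 * (F 0 i * F 1 j + F 1 i * F 0 j) + gram z U 1 1 * (F 1 i * F 1 j) := by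
  rw [gram_mul]
  simp [Matrix.mul_apply, Fin.sum_univ_two, gram_symm]
  ring

theorem gram_pos (z : ℍ) {U : Matrix (Fin 2) (Fin 2) ℝ} (hU : U.det ≠ 0) (i : Fin 2) :
    0 < gram z U i i := by
  have h : gram z U i i = (U 0 i - U 1 i * z.re) ^ 2 + (U 1 i * z.im) ^ 2 := by
    rw [gram_apply]; ring
  rw [h]
  by_cases h1 : U 1 i = 0
  · have h0 : U 0 i ≠ 0 := by
      intro h0
      apply hU
      rw [Matrix.det_fin_two]
      fin_cases i <;> simp_all
    rw [h1]
    simp only [zero_mul, sub_zero]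
    positivity
  · have := z.im_pos
    positivity

theorem gram_apply_eq_re (z : ℍ) (U : Matrix (Fin 2) (Fin 2) ℝ) (i j : Fin 2) :
    gram z U i j =
      ((U 0 i - U 1 i * (z : ℂ)) * (starRingEnd ℂ) (U 0 j - U 1 j * (z : ℂ))).re := by
  rw [gram_apply]
  simp
  ring

/-- The squared norm of (u₀, u₁) at z is |u₀ - u₁ z|², and applying A to both the vector and the
point divides u₀ - u₁ z by the automorphy factor D. So k = |D|⁻². -/
theorem exists_gram_smul (A : Matrix.SpecialLinearGroup (Fin 2) ℝ) (z : ℍ) :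
    ∃ k : ℝ, 0 < k ∧ ∀ U, gram (A • z) (A.val * U) = k • gram z U := by
  have hd : A.val 0 0 * A.val 1 1 - A.val 0 1 * A.val 1 0 = 1 := by
    rw [← Matrix.det_fin_two]; exact A.2
  have hz := UpperHalfPlane.coe_specialLinearGroup_apply A z
  simp only [Algebra.algebraMap_self, RingHom.id_apply] at hz
  have hne : ((A.val 1 0 : ℝ) : ℂ) * (z : ℂ) + ((A.val 1 1 : ℝ) : ℂ) ≠ 0 := by
    intro h
    have him := congrArg Complex.im h
    have hre := congrArg Complex.re h
    simp [z.im_ne_zero] at him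
    simp [him] at hre
    rw [him, hre] at hd
    simp at hd
  rw [eq_div_iff hne] at hz
  obtain ⟨D, hD⟩ : ∃ D, D = ((A.val 1 0 : ℝ) : ℂ) * (z : ℂ) + ((A.val 1 1 : ℝ) : ℂ) := ⟨_, rfl⟩
  have hd' : ((A.val 0 0 : ℝ) : ℂ) * (A.val 1 1 : ℝ) - (A.val 0 1 : ℝ) * (A.val 1 0 : ℝ) = 1 := by
    exact_mod_cast hd
  have hN : 0 < Complex.normSq D := Complex.normSq_pos.2 (hD ▸ hne)
  refine ⟨(Complex.normSq D)⁻¹, inv_pos.2 hN, fun U => ?_⟩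
  have key : ∀ i, (((A.val * U) 0 i : ℝ) - ((A.val * U) 1 i : ℝ) * ((A • z : ℍ) : ℂ)) * D =
      U 0 i - U 1 i * (z : ℂ) := by
    intro i
    simp only [Matrix.mul_apply, Fin.sum_univ_two, Complex.ofReal_add, Complex.ofReal_mul]
    rw [← hD] at hz
    linear_combination (-(A.val 1 0 : ℂ) * (U 0 i : ℂ) - (A.val 1 1 : ℂ) * (U 1 i : ℂ)) * hz +
      ((A.val 0 0 : ℂ) * (U 0 i : ℂ) + (A.val 0 1 : ℂ) * (U 1 i : ℂ)) * hD +
      ((U 0 i : ℂ) - (U 1 i : ℂ) * (z : ℂ)) * hd'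
  ext i j
  rw [Matrix.smul_apply, smul_eq_mul, gram_apply_eq_re, gram_apply_eq_re, ← key i, ← key j,
    eq_inv_mul_iff_mul_eq₀ hN.ne', map_mul, ← Complex.re_ofReal_mul, Complex.normSq_eq_conj_mul_self]
  congr 1
  ring

/-- Surjectivity of the model: in the standard basis, z is read off from the entries by completing
the square; a general U is reduced to this by a congruence, which preserves positive definiteness.
-/
theorem exists_gram_eq {m n k : ℝ} (hm : 0 < m) (h : n ^ 2 < m * k) {U : Matrix (Fin 2) (Fin 2) ℝ}
    (hU : U.det ≠ 0) : ∃ z : ℍ, ∃ c : ℝ, 0 < c ∧ gram z U = c • !![m, n; n, k] := by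
  have std : ∀ m n k : ℝ, 0 < m → n ^ 2 < m * k →
      ∃ z : ℍ, gram z 1 = m⁻¹ • !![m, n; n, k] := by
    intro m n k hm h
    have hp : 0 < k / m - (n / m) ^ 2 := by
      have : k / m - (n / m) ^ 2 = (m * k - n ^ 2) / m ^ 2 := by field_simp
      rw [this]
      exact div_pos (by linarith) (by positivity)
    obtain ⟨z, hre, him⟩ : ∃ z : ℍ, z.re = -n / m ∧ z.im ^ 2 = k / m - (n / m) ^ 2 :=
      ⟨⟨⟨-n / m, √(k / m - (n / m) ^ 2)⟩, Real.sqrt_pos.2 hp⟩, rfl, Real.sq_sqrt hp.le⟩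
    refine ⟨z, ?_⟩
    ext i j
    fin_cases i <;> fin_cases j <;> simp [gram_apply, hre, him] <;> field_simp
    ring
  have hk : 0 < k := by
    by_contra! hk
    have := mul_nonpos_of_nonneg_of_nonpos hm.le hk
    linarith [sq_nonneg n]
  obtain ⟨V, hV⟩ : ∃ V, V = U⁻¹ := ⟨_, rfl⟩
  have hVU : V * U = 1 := hV ▸ Matrix.nonsing_inv_mul U (isUnit_iff_ne_zero.2 hU)
  have hVd : V.det ≠ 0 := fun h => by
    have := congrArg Matrix.det hVU
    rw [Matrix.det_mul, h] at this
    simp at this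
  have hT : ∃ m' n' k', V.transpose * !![m, n; n, k] * V = !![m', n'; n', k'] := by
    refine ⟨(V.transpose * !![m, n; n, k] * V) 0 0, (V.transpose * !![m, n; n, k] * V) 0 1,
      (V.transpose * !![m, n; n, k] * V) 1 1, ?_⟩
    ext i j
    fin_cases i <;> fin_cases j <;> simp [Matrix.mul_apply, Fin.sum_univ_two]
    ring
  obtain ⟨m', n', k', hT⟩ := hT
  have hdet := congrArg Matrix.det hT
  simp only [Matrix.det_mul, Matrix.det_transpose, Matrix.det_fin_two_of] at hdet
  have h00 := congrFun (congrFun hT 0) 0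
  simp [Matrix.mul_apply, Fin.sum_univ_two] at h00
  have hm' : 0 < m' := by
    have hlt : 0 < m * k - n ^ 2 := by linarith
    have e : m * m' = (m * V 0 0 + n * V 1 0) ^ 2 + (m * k - n ^ 2) * V 1 0 ^ 2 := by
      rw [← h00]; ring
    have : 0 < m * m' := by
      rw [e]
      by_cases h1 : V 1 0 = 0
      · have h0 : V 0 0 ≠ 0 := fun h0 => hVd (by rw [Matrix.det_fin_two, h0, h1]; ring)
        rw [h1]
        simp only [mul_zero, add_zero]
        positivity
      · positivity
    exact (mul_pos_iff_of_pos_left hm).1 this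
  obtain ⟨z, hz⟩ := std m' n' k' hm' (by
    have : 0 < V.det * (m * k - n * n) * V.det := by
      have : 0 < m * k - n * n := by linarith
      rw [mul_comm V.det, mul_assoc]
      exact mul_pos this (mul_self_pos.2 hVd)
    linarith)
  refine ⟨z, m'⁻¹, inv_pos.2 hm', ?_⟩
  rw [← one_mul U, gram_mul, hz, ← hT, Matrix.mul_smul, Matrix.smul_mul]
  congr 1
  calc U.transpose * (V.transpose * !![m, n; n, k] * V) * U
      = (V * U).transpose * !![m, n; n, k] * (V * U) := by
        simp only [Matrix.transpose_mul, Matrix.mul_assoc]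
    _ = _ := by rw [hVU]; simp

/-- Injectivity of the model. It is used to show that an isometry fixes a point. -/
theorem eq_of_gram_eq_smul {z w : ℍ} {k : ℝ} {U : Matrix (Fin 2) (Fin 2) ℝ} (hU : U.det ≠ 0)
    (h : gram z U = k • gram w U) : z = w := by
  have h1 : gram z 1 = k • gram w 1 := by
    have hUV : U * U⁻¹ = 1 := Matrix.mul_nonsing_inv U (isUnit_iff_ne_zero.2 hU)
    rw [← hUV, gram_mul, gram_mul, h, Matrix.mul_smul, Matrix.smul_mul]
  have e := fun i j => congrFun (congrFun h1 i) j
  have e00 := e 0 0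
  have e01 := e 0 1
  have e11 := e 1 1
  simp [gram_apply] at e00 e01 e11
  rw [← e00] at e01 e11
  have hre : z.re = w.re := by linarith
  have him : z.im = w.im := by
    rw [← sq_eq_sq₀ z.im_pos.le w.im_pos.le]
    rw [hre] at e11
    linarith
  exact UpperHalfPlane.ext (Complex.ext hre him)

/-! ### Frames of geodesic lines -/

namespace GeodesicLine

/-- The columns of `U` are vectors representing the endpoints of the geodesic line. -/
def IsFrame (l : GeodesicLine) (U : Matrix (Fin 2) (Fin 2) ℝ) : Prop :=
  ∃ a b : ℝ, a ≠ 0 ∧ b ≠ 0 ∧ (∀ i, U i 0 = a * l.p.rep i) ∧ ∀ i, U i 1 = b * l.q.rep i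

theorem rep_det_ne_zero (l : GeodesicLine) :
    l.p.rep 0 * l.q.rep 1 - l.p.rep 1 * l.q.rep 0 ≠ 0 := by
  intro h
  apply l.ne
  rw [← l.p.mk_rep, ← l.q.mk_rep, Projectivization.mk_eq_mk_iff']
  have hq := l.q.rep_nonzero
  by_cases h0 : l.q.rep 0 = 0
  · have h1 : l.q.rep 1 ≠ 0 := fun h1 => hq (by ext i; fin_cases i <;> simp [h0, h1])
    refine ⟨l.p.rep 1 / l.q.rep 1, ?_⟩
    ext i; fin_cases i <;> (simp; field_simp; try linarith)
  · refine ⟨l.p.rep 0 / l.q.rep 0, ?_⟩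
    ext i; fin_cases i <;> (simp; field_simp; try linarith)

theorem IsFrame.det_ne_zero {l : GeodesicLine} {U : Matrix (Fin 2) (Fin 2) ℝ} (h : l.IsFrame U) :
    U.det ≠ 0 := by
  obtain ⟨a, b, ha, hb, h1, h2⟩ := h
  rw [Matrix.det_fin_two, h1, h1, h2, h2]
  have := mul_ne_zero (mul_ne_zero ha hb) l.rep_det_ne_zero
  intro h
  exact this (by linarith)

theorem exists_isFrame (l : GeodesicLine) {c : ℝ} (hc : c ≠ 0) :
    ∃ U, l.IsFrame U ∧ ∀ z, gram z U 0 1 = c * l.eqn z := by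
  refine ⟨!![l.p.rep 0, c * l.q.rep 0; l.p.rep 1, c * l.q.rep 1], ⟨1, c, one_ne_zero, hc, ?_, ?_⟩,
    ?_⟩
  · intro i; fin_cases i <;> simp
  · intro i; fin_cases i <;> simp
  · intro z
    rw [gram_apply, eqn]
    simp
    ring

theorem IsFrame.mem_carrier_iff {l : GeodesicLine} {U : Matrix (Fin 2) (Fin 2) ℝ}
    (h : l.IsFrame U) (z : ℍ) : z ∈ l.carrier ↔ gram z U 0 1 = 0 := by
  obtain ⟨a, b, ha, hb, h1, h2⟩ := h
  have : gram z U 0 1 = a * b * l.eqn z := by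
    rw [gram_apply, h1, h1, h2, h2, eqn]; ring
  rw [this, mul_eq_zero, or_iff_right (mul_ne_zero ha hb)]
  rfl

end GeodesicLine

/-! ### Properties in G₀ read on matrix representatives, defined up to sign -/

namespace G₀

open Matrix hiding gram

theorem mk_eq_mk_iff {A B : Matrix.SpecialLinearGroup (Fin 2) ℝ} :
    (A : G₀) = (B : G₀) ↔ A = B ∨ A = -B := by
  rw [QuotientGroup.eq, Matrix.SpecialLinearGroup.mem_center_iff]
  constructor
  · rintro ⟨r, hr, h⟩
    have hB : B.val = A.val * scalar (Fin 2) r := by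
      rw [h]
      exact congrArg Subtype.val (mul_inv_cancel_left A B).symm
    rw [Fintype.card_fin, sq_eq_one_iff] at hr
    rcases hr with rfl | rfl
    · left; ext i j; rw [hB]; simp
    · right; ext i j; rw [SpecialLinearGroup.coe_neg, hB]; simp
  · rintro (rfl | rfl)
    · exact ⟨1, by simp, by simp⟩
    · refine ⟨-1, by simp, ?_⟩
      have : (-B)⁻¹ * B = -1 := by
        rw [inv_mul_eq_iff_eq_mul]; simp
      rw [this]
      ext i j; fin_cases i <;> fin_cases j <;> simp

theorem isElliptic_mk_iff {A : Matrix.SpecialLinearGroup (Fin 2) ℝ} :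
    IsElliptic (A : G₀) ↔ A.val.trace ^ 2 < 4 := by
  have key (B : SpecialLinearGroup (Fin 2) ℝ) : B.val.IsElliptic ↔ B.val.trace ^ 2 < 4 := by
    rw [Matrix.IsElliptic, discr_fin_two, B.2]; constructor <;> intro h <;> linarith
  refine ⟨?_, fun h => ⟨A, rfl, (key A).2 h⟩⟩
  rintro ⟨B, hB, h⟩
  rw [key] at h
  rcases mk_eq_mk_iff.1 hB with rfl | rfl
  · exact h
  · simpa using h

theorem isHyperbolic_mk_iff {A : Matrix.SpecialLinearGroup (Fin 2) ℝ} :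
    IsHyperbolic (A : G₀) ↔ 4 < A.val.trace ^ 2 := by
  have key (B : SpecialLinearGroup (Fin 2) ℝ) : B.val.IsHyperbolic ↔ 4 < B.val.trace ^ 2 := by
    rw [Matrix.IsHyperbolic, discr_fin_two, B.2]; constructor <;> intro h <;> linarith
  refine ⟨?_, fun h => ⟨A, rfl, (key A).2 h⟩⟩
  rintro ⟨B, hB, h⟩
  rw [key] at h
  rcases mk_eq_mk_iff.1 hB with rfl | rfl
  · exact h
  · simpa using h

theorem trace_sq_eq_of_isParabolic_mk {A : SpecialLinearGroup (Fin 2) ℝ}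
    (h : IsParabolic (A : G₀)) : A.val.trace ^ 2 = 4 := by
  obtain ⟨B, hB, -, h⟩ := h
  rw [discr_fin_two, B.2] at h
  rcases mk_eq_mk_iff.1 hB with rfl | rfl
  · linarith
  · simp at h
    linarith

theorem isParabolic_mk {A : SpecialLinearGroup (Fin 2) ℝ}
    (h : A.val ∉ Set.range (scalar (Fin 2))) (h2 : A.val.trace ^ 2 = 4) : IsParabolic (A : G₀) :=
  ⟨A, rfl, h, by rw [discr_fin_two, A.2, h2]; ring⟩

theorem hasAttractingPoint_mk_iff {A : SpecialLinearGroup (Fin 2) ℝ} {ξ : IdealBoundary} :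
    HasAttractingPoint (A : G₀) ξ ↔ ∃ c : ℝ, 1 < |c| ∧ A.val *ᵥ ξ.rep = c • ξ.rep := by
  refine ⟨?_, fun h => ⟨A, rfl, h⟩⟩
  rintro ⟨B, hB, c, hc, h⟩
  rcases mk_eq_mk_iff.1 hB with rfl | rfl
  · exact ⟨c, hc, h⟩
  · refine ⟨-c, by rwa [abs_neg], ?_⟩
    rw [neg_smul, ← h]
    simp [neg_mulVec]

theorem mk_smul_eq_iff {A : SpecialLinearGroup (Fin 2) ℝ} {ξ : IdealBoundary} :
    (A : G₀) • ξ = ξ ↔ ∃ c : ℝ, A.val *ᵥ ξ.rep = c • ξ.rep := by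
  rw [Matrix.ProjectiveSpecialLinearGroup.smul_proj_mk]
  conv_lhs => lhs; rw [← ξ.mk_rep]
  conv_lhs => rhs; rw [← ξ.mk_rep]
  rw [Projectivization.smul_mk, Projectivization.mk_eq_mk_iff']
  exact exists_congr fun c => eq_comm

end G₀

/-! ### Change of basis -/

section conjugation

open Matrix hiding gram

variable {A U F : Matrix (Fin 2) (Fin 2) ℝ}

theorem eq_of_mul_eq_mul_of_det_ne_zero {X Y : Matrix (Fin 2) (Fin 2) ℝ} (hU : U.det ≠ 0)
    (h : U * X = U * Y) : X = Y := by
  have hu : IsUnit U.det := isUnit_iff_ne_zero.2 hU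
  rw [← nonsing_inv_mul_cancel_left U X hu, h, nonsing_inv_mul_cancel_left U Y hu]

theorem exists_eq_mul (hU : U.det ≠ 0) (V : Matrix (Fin 2) (Fin 2) ℝ) : ∃ W, V = U * W :=
  ⟨U⁻¹ * V, (mul_nonsing_inv_cancel_left _ _ (isUnit_iff_ne_zero.2 hU)).symm⟩

theorem exists_specialLinearGroup_mul_eq_mul (hU : U.det ≠ 0) (hF : F.det = 1) :
    ∃ A : SpecialLinearGroup (Fin 2) ℝ, A.val * U = U * F := by
  have hu : IsUnit U.det := isUnit_iff_ne_zero.2 hU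
  refine ⟨⟨U * F * U⁻¹, ?_⟩, nonsing_inv_mul_cancel_right _ _ hu⟩
  rw [det_mul, det_mul, hF, mul_one, ← det_mul, mul_nonsing_inv _ hu, det_one]

theorem det_eq_of_mul_eq_mul (hU : U.det ≠ 0) (h : A * U = U * F) : F.det = A.det := by
  have := congrArg Matrix.det h
  rw [det_mul, det_mul, mul_comm] at this
  exact (mul_left_cancel₀ hU this).symm

theorem trace_eq_of_mul_eq_mul (hU : U.det ≠ 0) (h : A * U = U * F) : F.trace = A.trace := by
  have hu : IsUnit U.det := isUnit_iff_ne_zero.2 hU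
  have hF : F = U⁻¹ * (A * U) := by rw [h, nonsing_inv_mul_cancel_left _ _ hu]
  rw [hF, trace_mul_comm, Matrix.mul_assoc, mul_nonsing_inv _ hu, Matrix.mul_one]

/-- The Gram matrix of a frame at the image of a point. -/
theorem exists_gram_smul_eq {A : SpecialLinearGroup (Fin 2) ℝ} (hU : U.det ≠ 0)
    (h : A.val * U = U * F) (z : ℍ) :
    ∃ k : ℝ, 0 < k ∧ _root_.gram (A • z) U =
      k • _root_.gram z (U * !![F 1 1, -F 0 1; -F 1 0, F 0 0]) := by
  obtain ⟨k, hk, hg⟩ := exists_gram_smul A z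
  refine ⟨k, hk, ?_⟩
  rw [← hg, ← Matrix.mul_assoc, h, Matrix.mul_assoc]
  have hd := det_eq_of_mul_eq_mul hU h
  rw [A.2, det_fin_two] at hd
  have : F * !![F 1 1, -F 0 1; -F 1 0, F 0 0] = 1 := by
    ext i j
    fin_cases i <;> fin_cases j <;> simp [Matrix.mul_apply, Fin.sum_univ_two] <;> linarith
  rw [this, Matrix.mul_one]

end conjugation

/-! ### Crooked planes and stem quadrants in a frame -/

namespace GeodesicLine

open Matrix hiding gram

variable {l : GeodesicLine} {U : Matrix (Fin 2) (Fin 2) ℝ}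

theorem exists_isFrame_eq (hU : U.det ≠ 0) : ∃ m : GeodesicLine, m.IsFrame U := by
  have h0 : (fun i => U i 0) ≠ 0 := fun h => hU (by
    rw [det_fin_two, show U 0 0 = 0 from congrFun h 0, show U 1 0 = 0 from congrFun h 1]; ring)
  have h1 : (fun i => U i 1) ≠ 0 := fun h => hU (by
    rw [det_fin_two, show U 0 1 = 0 from congrFun h 0, show U 1 1 = 0 from congrFun h 1]; ring)
  refine ⟨⟨Projectivization.mk ℝ _ h0, Projectivization.mk ℝ _ h1, fun h => ?_⟩, ?_⟩
  · rw [Projectivization.mk_eq_mk_iff'] at h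
    obtain ⟨a, ha⟩ := h
    have e0 := congrFun ha 0
    have e1 := congrFun ha 1
    simp only [Pi.smul_apply, smul_eq_mul] at e0 e1
    exact hU (by rw [det_fin_two, ← e0, ← e1]; ring)
  · obtain ⟨a, ha⟩ := Projectivization.exists_smul_eq_mk_rep ℝ _ h0
    obtain ⟨b, hb⟩ := Projectivization.exists_smul_eq_mk_rep ℝ _ h1
    refine ⟨(a : ℝ)⁻¹, (b : ℝ)⁻¹, inv_ne_zero a.ne_zero, inv_ne_zero b.ne_zero, ?_, ?_⟩
    · intro i
      rw [← ha, Pi.smul_apply, Units.smul_def, smul_eq_mul, inv_mul_cancel_left₀ a.ne_zero]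
    · intro i
      rw [← hb, Pi.smul_apply, Units.smul_def, smul_eq_mul, inv_mul_cancel_left₀ b.ne_zero]

theorem IsFrame.mulVec_p_iff (hl : l.IsFrame U) {A F : Matrix (Fin 2) (Fin 2) ℝ}
    (h : A * U = U * F) {c : ℝ} : A *ᵥ l.p.rep = c • l.p.rep ↔ F 0 0 = c ∧ F 1 0 = 0 := by
  have hU := hl.det_ne_zero
  obtain ⟨a, b, ha, hb, h1, h2⟩ := hl
  have e : ∀ i, a * (A *ᵥ l.p.rep) i = U i 0 * F 0 0 + U i 1 * F 1 0 := by
    intro i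
    have := congrFun (congrFun h i) 0
    simp only [Matrix.mul_apply, Fin.sum_univ_two, h1] at this
    simp only [mulVec, dotProduct, Fin.sum_univ_two]
    rw [h1]; linarith
  constructor
  · intro hc
    have e' : ∀ i, U i 0 * (c - F 0 0) = U i 1 * F 1 0 := fun i => by
      have := e i
      rw [hc, Pi.smul_apply, smul_eq_mul] at this
      have h1 := h1 i
      linear_combination this + c * h1
    rw [det_fin_two] at hU
    have z1 : F 1 0 = 0 := by
      refine mul_left_cancel₀ hU ?_
      linear_combination -U 0 0 * e' 1 + U 1 0 * e' 0
    have z2 : c - F 0 0 = 0 := by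
      refine mul_left_cancel₀ hU ?_
      linear_combination U 1 1 * e' 0 - U 0 1 * e' 1
    exact ⟨by linarith, z1⟩
  · rintro ⟨rfl, hz⟩
    ext i
    refine mul_left_cancel₀ ha ?_
    rw [e, hz, h1, Pi.smul_apply, smul_eq_mul]
    ring

theorem IsFrame.mulVec_q_iff (hl : l.IsFrame U) {A F : Matrix (Fin 2) (Fin 2) ℝ}
    (h : A * U = U * F) {c : ℝ} : A *ᵥ l.q.rep = c • l.q.rep ↔ F 1 1 = c ∧ F 0 1 = 0 := by
  have hU := hl.det_ne_zero
  obtain ⟨a, b, ha, hb, h1, h2⟩ := hl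
  have e : ∀ i, b * (A *ᵥ l.q.rep) i = U i 0 * F 0 1 + U i 1 * F 1 1 := by
    intro i
    have := congrFun (congrFun h i) 1
    simp only [Matrix.mul_apply, Fin.sum_univ_two, h2] at this
    simp only [mulVec, dotProduct, Fin.sum_univ_two]
    rw [h2]; linarith
  constructor
  · intro hc
    have e' : ∀ i, U i 1 * (c - F 1 1) = U i 0 * F 0 1 := fun i => by
      have := e i
      rw [hc, Pi.smul_apply, smul_eq_mul] at this
      have h2 := h2 i
      linear_combination this + c * h2
    rw [det_fin_two] at hU
    have z1 : F 0 1 = 0 := by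
      refine mul_left_cancel₀ hU ?_
      linear_combination U 0 1 * e' 1 - U 1 1 * e' 0
    have z2 : c - F 1 1 = 0 := by
      refine mul_left_cancel₀ hU ?_
      linear_combination -U 1 0 * e' 0 + U 0 0 * e' 1
    exact ⟨by linarith, z1⟩
  · rintro ⟨rfl, hz⟩
    ext i
    refine mul_left_cancel₀ hb ?_
    rw [e, hz, h2, Pi.smul_apply, smul_eq_mul]
    ring

theorem IsFrame.smul_p_iff (hl : l.IsFrame U) {A : SpecialLinearGroup (Fin 2) ℝ}
    {F : Matrix (Fin 2) (Fin 2) ℝ} (h : A.val * U = U * F) : (A : G₀) • l.p = l.p ↔ F 1 0 = 0 := by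
  simp only [G₀.mk_smul_eq_iff, hl.mulVec_p_iff h]
  simp

theorem IsFrame.smul_q_iff (hl : l.IsFrame U) {A : SpecialLinearGroup (Fin 2) ℝ}
    {F : Matrix (Fin 2) (Fin 2) ℝ} (h : A.val * U = U * F) : (A : G₀) • l.q = l.q ↔ F 0 1 = 0 := by
  simp only [G₀.mk_smul_eq_iff, hl.mulVec_q_iff h]
  simp

/-- Two lines are orthogonal exactly when their pairs of endpoints are harmonic, that is, the ratios
K 0 0 / K 1 0 and K 0 1 / K 1 1 are opposite. -/
theorem IsFrame.orthogonalAt_iff (hl : l.IsFrame U) {m : GeodesicLine}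
    {K : Matrix (Fin 2) (Fin 2) ℝ} (hm : m.IsFrame (U * K)) {z : ℍ} (hz : z ∈ l.carrier)
    (hz' : z ∈ m.carrier) : l.OrthogonalAt m z ↔ K 0 0 * K 1 1 + K 0 1 * K 1 0 = 0 := by
  have hU := hl.det_ne_zero
  rw [OrthogonalAt, and_iff_right hz, and_iff_right hz']
  rw [hl.mem_carrier_iff, gram_apply] at hz
  rw [hm.mem_carrier_iff, gram_apply] at hz'
  obtain ⟨a, b, ha, hb, h1, h2⟩ := hl
  obtain ⟨a', b', ha', hb', h1', h2'⟩ := hm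
  have key : a * b * (a' * b') * ((l.normal z).1 * (m.normal z).1 +
      (l.normal z).2 * (m.normal z).2) = U.det ^ 2 * (K 0 0 * K 1 1 + K 0 1 * K 1 0) := by
    have n1 : a * b * (l.normal z).1 = 2 * (U 1 0 * U 1 1) * z.re -
        (U 0 0 * U 1 1 + U 1 0 * U 0 1) := by rw [h1, h1, h2, h2, normal]; ring
    have n2 : a * b * (l.normal z).2 = 2 * (U 1 0 * U 1 1) * z.im := by
      rw [h1, h2, normal]; ring
    have n1' : a' * b' * (m.normal z).1 = 2 * ((U * K) 1 0 * (U * K) 1 1) * z.re -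
        ((U * K) 0 0 * (U * K) 1 1 + (U * K) 1 0 * (U * K) 0 1) := by
      rw [h1', h1', h2', h2', normal]; ring
    have n2' : a' * b' * (m.normal z).2 = 2 * ((U * K) 1 0 * (U * K) 1 1) * z.im := by
      rw [h1', h2', normal]; ring
    calc _ = (a * b * (l.normal z).1) * (a' * b' * (m.normal z).1) +
          (a * b * (l.normal z).2) * (a' * b' * (m.normal z).2) := by ring
      _ = _ := by
        rw [n1, n2, n1', n2', det_fin_two]
        simp only [Matrix.mul_apply, Fin.sum_univ_two] at hz' ⊢
        linear_combination 2 * (U 1 0 * K 0 0 + U 1 1 * K 1 0) * (U 1 0 * K 0 1 + U 1 1 * K 1 1) * hz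
          + 2 * U 1 0 * U 1 1 * hz'
  have hab : a * b * (a' * b') ≠ 0 := by positivity
  rw [← mul_right_inj' hab, key, mul_zero, mul_eq_zero, or_iff_right (by positivity)]

/-- The triangular cases of `CrookedCond` are the wings when the diagonal entry exceeds one in
absolute value, and the identity or parabolics when it equals one. The third case is elliptic: F
preserves a scalar product for which the frame is orthogonal. -/
theorem IsFrame.mem_leftCrookedPlane_iff (hl : l.IsFrame U) {A : SpecialLinearGroup (Fin 2) ℝ}
    {F : Matrix (Fin 2) (Fin 2) ℝ} (h : A.val * U = U * F) :
    (A : G₀) ∈ l.leftCrookedPlane ↔ CrookedCond F := by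
  have hU := hl.det_ne_zero
  have hd := det_eq_of_mul_eq_mul hU h
  have ht := trace_eq_of_mul_eq_mul hU h
  rw [A.2, det_fin_two] at hd
  rw [trace_fin_two] at ht
  have one_le_abs (s t : ℝ) (h1 : s * t = 1) (h2 : (s + t) ^ 2 = 4) : 1 ≤ |s| := by
    have : (s - t) ^ 2 = 0 := by linear_combination h2 - 4 * h1
    have hst : s = t := sub_eq_zero.1 (pow_eq_zero_iff two_ne_zero |>.1 this)
    rw [← hst] at h1
    rw [← one_le_sq_iff_one_le_abs]
    linarith
  have hyp (s t : ℝ) (h1 : s * t = 1) (h2 : 1 < |s|) : 4 < (s + t) ^ 2 := by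
    have : s ≠ t := by
      rintro rfl
      rw [← one_lt_sq_iff_one_lt_abs] at h2
      linarith
    have := sq_pos_of_ne_zero (sub_ne_zero.2 this)
    linarith
  have par (s t : ℝ) (h1 : s * t = 1) (h2 : |s| = 1) : t = s ∧ s * s = 1 := by
    have : s * s = 1 := by rw [← abs_mul_abs_self, h2]; norm_num
    exact ⟨mul_left_cancel₀ (left_ne_zero_of_mul_eq_one h1) (h1.trans this.symm), this⟩
  -- scalar matrices
  have scal (s : ℝ) (hs : A.val = scalar (Fin 2) s) : F = scalar (Fin 2) s := by
    have : U * F = U * scalar (Fin 2) s := by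
      rw [← h, hs, (scalar_commute s (fun r => mul_comm _ _) U).eq]
    exact eq_of_mul_eq_mul_of_det_ne_zero hU this
  constructor
  · rintro ((⟨hA, z, hz, hAz⟩ | hA | ⟨hA, hp⟩) | ⟨-, hA⟩ | ⟨-, hA⟩)
    · rw [G₀.isElliptic_mk_iff, ← ht] at hA
      rw [hl.mem_carrier_iff] at hz
      rw [G₀.mk_smul] at hAz
      obtain ⟨k, hk, hg⟩ := exists_gram_smul_eq hU h z
      rw [hAz] at hg
      have g0 := gram_pos z hU 0
      have g1 := gram_pos z hU 1
      have e := fun i j => congrFun (congrFun hg i) j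
      have e00 := e 0 0
      have e01 := e 0 1
      have e11 := e 1 1
      simp only [Matrix.smul_apply, gram_mul_apply, hz, smul_eq_mul] at e00 e01 e11
      simp only [of_apply, cons_val', cons_val_zero, cons_val_fin_one, cons_val_one] at e00 e01 e11
      clear e hg hAz
      generalize gram z U 0 0 = g at *
      generalize gram z U 1 1 = m at *
      -- With D the diagonal Gram matrix at the fixed point, Fᵀ D = k D F⁻¹; this is its first
      -- diagonal entry, and `e2` the second.
      have e1 : k * F 1 1 = F 0 0 := by
        refine mul_left_cancel₀ g0.ne' ?_
        linear_combination -k * g * F 1 1 * hd - F 0 0 * e00 - F 1 0 * e01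
      have e2 : k * F 0 0 = F 1 1 := by
        refine mul_left_cancel₀ g1.ne' ?_
        linear_combination -k * m * F 0 0 * hd - F 1 1 * e11 - F 0 1 * e01
      have e3 : (1 + k) * (F 0 0 - F 1 1) = 0 := by linear_combination e2 - e1
      have e4 := sub_eq_zero.1 ((mul_eq_zero.1 e3).resolve_left (by positivity))
      refine Or.inr (Or.inr ⟨e4, ?_⟩)
      rw [← sq_lt_one_iff_abs_lt_one]
      rw [← e4] at hA
      linarith
    · have hA' : (A : G₀) = ((1 : SpecialLinearGroup (Fin 2) ℝ) : G₀) := hA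
      rw [G₀.mk_eq_mk_iff] at hA'
      rcases hA' with rfl | rfl
      · have := scal 1 (by ext i j; simp)
        left; simp [this]
      · have := scal (-1) (by ext i j; fin_cases i <;> fin_cases j <;> simp)
        left; simp [this]
    · have h4 := G₀.trace_sq_eq_of_isParabolic_mk hA
      rw [← ht] at h4
      rw [hl.smul_p_iff h, hl.smul_q_iff h] at hp
      rcases hp with hp | hp
      · exact Or.inl ⟨hp, one_le_abs _ (F 1 1) (by rw [hp] at hd; linarith) h4⟩
      · exact Or.inr (Or.inl ⟨hp, one_le_abs _ (F 0 0) (by rw [hp] at hd; linarith)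
          (by linarith)⟩)
    · rw [G₀.hasAttractingPoint_mk_iff] at hA
      obtain ⟨c, hc, hA⟩ := hA
      rw [hl.mulVec_p_iff h] at hA
      exact Or.inl ⟨hA.2, hA.1 ▸ hc.le⟩
    · rw [G₀.hasAttractingPoint_mk_iff] at hA
      obtain ⟨c, hc, hA⟩ := hA
      rw [hl.mulVec_q_iff h] at hA
      exact Or.inr (Or.inl ⟨hA.2, hA.1 ▸ hc.le⟩)
  · have triangular (hF : F 1 0 = 0 ∨ F 0 1 = 0) (h1 : |F 0 0| = 1) (h2 : F 0 0 * F 1 1 = 1) :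
        (A : G₀) ∈ l.leftCrookedPlane := by
      obtain ⟨h3, h4⟩ := par _ _ h2 h1
      left; right
      by_cases hs : A.val ∈ Set.range (scalar (Fin 2))
      · left
        obtain ⟨s, hs⟩ := hs
        have hFs := scal s hs.symm
        have : F 0 0 = s := by rw [hFs]; simp
        rw [this] at h4
        rw [Set.mem_singleton_iff]
        refine (G₀.mk_eq_mk_iff (B := 1)).2 ?_
        rcases mul_self_eq_one_iff.1 h4 with rfl | rfl
        · left; ext i j; rw [← hs]; simp
        · right; ext i j; rw [← hs]; fin_cases i <;> fin_cases j <;> simp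
      · right
        refine ⟨G₀.isParabolic_mk hs ?_, ?_⟩
        · rw [← ht, h3]; linarith
        · rwa [hl.smul_p_iff h, hl.smul_q_iff h]
    rintro (⟨h0, h1⟩ | ⟨h0, h1⟩ | ⟨h0, h1⟩)
    · have h2 : F 0 0 * F 1 1 = 1 := by rw [h0] at hd; linarith
      rcases h1.eq_or_lt with h1 | h1
      · exact triangular (Or.inl h0) h1.symm h2
      · refine Or.inr (Or.inl ⟨?_, ?_⟩)
        · rw [G₀.isHyperbolic_mk_iff, ← ht]; exact hyp _ _ h2 h1
        · rw [G₀.hasAttractingPoint_mk_iff]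
          exact ⟨_, h1, (hl.mulVec_p_iff h).2 ⟨rfl, h0⟩⟩
    · have h2 : F 1 1 * F 0 0 = 1 := by rw [h0] at hd; linarith
      rcases h1.eq_or_lt with h1 | h1
      · have := par _ _ h2 h1.symm
        exact triangular (Or.inr h0) (by rw [this.1]; exact h1.symm) (by linarith)
      · refine Or.inr (Or.inr ⟨?_, ?_⟩)
        · rw [G₀.isHyperbolic_mk_iff, ← ht, add_comm]; exact hyp _ _ h2 h1
        · rw [G₀.hasAttractingPoint_mk_iff]
          exact ⟨_, h1, (hl.mulVec_q_iff h).2 ⟨rfl, h0⟩⟩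
    · left; left
      rw [← sq_lt_one_iff_abs_lt_one] at h1
      rw [← h0] at hd ht
      have hyz : F 0 1 * F 1 0 < 0 := by linarith
      obtain ⟨y', z', hy, hz, e⟩ : ∃ y' z' : ℝ, 0 < y' ∧ 0 < z' ∧
          (F 0 1 = y' ∧ F 1 0 = -z' ∨ F 0 1 = -y' ∧ F 1 0 = z') := by
        rcases mul_neg_iff.1 hyz with ⟨a, b⟩ | ⟨a, b⟩
        · exact ⟨F 0 1, -F 1 0, a, neg_pos.2 b, Or.inl ⟨rfl, by ring⟩⟩
        · exact ⟨-F 0 1, F 1 0, neg_pos.2 a, b, Or.inr ⟨by ring, rfl⟩⟩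
      have hyz' : F 0 0 * F 0 0 + y' * z' = 1 := by
        rcases e with ⟨e1, e2⟩ | ⟨e1, e2⟩ <;> rw [e1, e2] at hd <;> linarith
      -- F preserves the scalar product diag(|F 1 0|, |F 0 1|), so the corresponding point is fixed;
      -- it lies on the line because the matrix is diagonal.
      obtain ⟨z, c, hc, hg⟩ := exists_gram_eq (m := z') (n := 0) (k := y') hz
        (by rw [zero_pow two_ne_zero]; positivity) hU
      refine ⟨?_, z, ?_, ?_⟩
      · rw [G₀.isElliptic_mk_iff, ← ht]; linarith
      · rw [hl.mem_carrier_iff, hg]; simp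
      · rw [G₀.mk_smul]
        obtain ⟨k, hk, hk'⟩ := exists_gram_smul_eq hU h z
        refine eq_of_gram_eq_smul (k := k) hU ?_
        rw [hk']
        congr 1
        ext i j
        rw [gram_mul_apply, hg, ← h0]
        rcases e with ⟨e1, e2⟩ | ⟨e1, e2⟩ <;> rw [e1, e2] <;>
          fin_cases i <;> fin_cases j <;> simp
        · linear_combination c * z' * hyz'
        · ring
        · ring
        · linear_combination c * y' * hyz'
        · linear_combination c * z' * hyz'
        · ring
        · ring
        · linear_combination c * y' * hyz'

/-- An axis orthogonal to the line means equal diagonal entries. Hyperbolicity then gives the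
off-diagonal entries a common sign, and their sign relative to F 0 0 tells to which side points of
the line are moved. -/
theorem IsFrame.mem_stemQuadrant_iff (hl : l.IsFrame U) {o : l.TransverseOrientation} {s : ℝ}
    (ho : o.positiveSide = {z | 0 < s * gram z U 0 1}) {A : SpecialLinearGroup (Fin 2) ℝ}
    {F : Matrix (Fin 2) (Fin 2) ℝ} (h : A.val * U = U * F) :
    (A : G₀) ∈ l.stemQuadrant o ↔
      F 0 0 = F 1 1 ∧ s * (F 0 0 * F 0 1) < 0 ∧ s * (F 0 0 * F 1 0) < 0 := by
  have hU := hl.det_ne_zero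
  have hd := det_eq_of_mul_eq_mul hU h
  have ht := trace_eq_of_mul_eq_mul hU h
  rw [A.2, det_fin_two] at hd
  rw [trace_fin_two] at ht
  -- the position of the image of a point of the line
  have pos : ∀ z ∈ l.carrier, ((A : G₀) • z ∈ o.positiveSide ↔
      s * (gram z U 0 0 * (F 1 1 * F 0 1) + gram z U 1 1 * (F 1 0 * F 0 0)) < 0) := by
    intro z hz
    rw [hl.mem_carrier_iff] at hz
    obtain ⟨k, hk, hg⟩ := exists_gram_smul_eq hU h z
    have e := congrFun (congrFun hg 0) 1
    simp only [Matrix.smul_apply, gram_mul_apply, hz, smul_eq_mul] at e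
    simp only [of_apply, cons_val', cons_val_zero, cons_val_fin_one, cons_val_one] at e
    have e' : s * gram (A • z) U 0 1 =
        k * -(s * (gram z U 0 0 * (F 1 1 * F 0 1) + gram z U 1 1 * (F 1 0 * F 0 0))) := by
      rw [e]; ring
    rw [ho, Set.mem_ofPred_eq, G₀.mk_smul, e', mul_pos_iff_of_pos_left hk, neg_pos]
  constructor
  · rintro ⟨m, ⟨hA, hp, hq⟩, z, hz, hAz⟩
    obtain ⟨V, hm, -⟩ := m.exists_isFrame one_ne_zero
    obtain ⟨K, hK⟩ := exists_eq_mul hU V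
    obtain ⟨G, hG⟩ := exists_eq_mul hm.det_ne_zero (A.val * V)
    rw [hm.smul_p_iff hG] at hp
    rw [hm.smul_q_iff hG] at hq
    have hKd := hm.det_ne_zero
    rw [hK] at hKd hG hm
    have hz1 := hz.1
    rw [hl.orthogonalAt_iff hm hz.1 hz.2.1] at hz
    rw [pos z hz1] at hAz
    have hFK : F * K = K * G := by
      have : U * (F * K) = U * (K * G) := by
        rw [← Matrix.mul_assoc, ← h, Matrix.mul_assoc, hG, Matrix.mul_assoc]
      exact eq_of_mul_eq_mul_of_det_ne_zero hU this
    have hF : F 0 0 = F 1 1 := by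
      have hKd' : K.det ≠ 0 := fun h0 => hKd (by rw [det_mul, h0, mul_zero])
      have e := fun i j => congrFun (congrFun hFK i) j
      have e00 := e 0 0
      have e01 := e 0 1
      have e10 := e 1 0
      have e11 := e 1 1
      simp only [Matrix.mul_apply, Fin.sum_univ_two, hp, hq] at e00 e01 e10 e11
      rw [det_fin_two] at hKd'
      refine mul_left_cancel₀ hKd' ?_
      -- As F = K G K⁻¹ with G diagonal, F 0 0 - F 1 1 is (G 0 0 - G 1 1)(K 0 0 K 1 1 + K 0 1 K 1 0)
      -- / det K, which vanishes by orthogonality.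
      linear_combination K 1 1 * e00 - K 1 0 * e01 - K 0 0 * e11 + K 0 1 * e10 +
        (G 0 0 - G 1 1) * hz
    refine ⟨hF, ?_⟩
    rw [G₀.isHyperbolic_mk_iff, ← ht, ← hF] at hA
    rw [← hF] at hd hAz
    have g0 := gram_pos z hU 0
    have g1 := gram_pos z hU 1
    generalize gram z U 0 0 = g at *
    generalize gram z U 1 1 = g' at *
    have hs : s ≠ 0 := by rintro rfl; simp at hAz
    have hx : 0 < F 0 0 * F 0 0 := by linarith
    have hyz : 0 < F 0 1 * F 1 0 := by linarith
    have hprod : 0 < (s * (F 0 0 * F 0 1)) * (s * (F 0 0 * F 1 0)) := by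
      have : (s * (F 0 0 * F 0 1)) * (s * (F 0 0 * F 1 0)) =
        s ^ 2 * (F 0 0 * F 0 0) * (F 0 1 * F 1 0) := by ring
      rw [this]; positivity
    rcases mul_pos_iff.1 hprod with ⟨h1, h2⟩ | h12
    · have := mul_pos g0 h1
      have := mul_pos g1 h2
      linarith
    · exact h12
  · rintro ⟨h1, h2, h3⟩
    have hyz : 0 < F 0 1 * F 1 0 := by
      have h4 := mul_pos_of_neg_of_neg h2 h3
      have h5 : s * (F 0 0 * F 0 1) * (s * (F 0 0 * F 1 0)) =
        (s * F 0 0) ^ 2 * (F 0 1 * F 1 0) := by ring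
      rw [h5] at h4
      exact pos_of_mul_pos_right h4 (sq_nonneg _)
    obtain ⟨σ, η, ζ, hσ, hη, hζ, hy, hz⟩ : ∃ σ η ζ : ℝ, σ * σ = 1 ∧ 0 < η ∧ 0 < ζ ∧
        F 0 1 = σ * η ^ 2 ∧ F 1 0 = σ * ζ ^ 2 := by
      rcases mul_pos_iff.1 hyz with ⟨a, b⟩ | ⟨a, b⟩
      · refine ⟨1, √(F 0 1), √(F 1 0), by norm_num, Real.sqrt_pos.2 a, Real.sqrt_pos.2 b, ?_, ?_⟩
        · rw [Real.sq_sqrt a.le]; ring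
        · rw [Real.sq_sqrt b.le]; ring
      · refine ⟨-1, √(-F 0 1), √(-F 1 0), by norm_num, Real.sqrt_pos.2 (neg_pos.2 a),
          Real.sqrt_pos.2 (neg_pos.2 b), ?_, ?_⟩
        · rw [Real.sq_sqrt (neg_pos.2 a).le]; ring
        · rw [Real.sq_sqrt (neg_pos.2 b).le]; ring
    -- The columns are eigenvectors of F, so they span the endpoints of the axis.
    obtain ⟨K, hK⟩ : ∃ K, K = !![η, η; ζ, -ζ] := ⟨_, rfl⟩
    have hKd : (U * K).det ≠ 0 := by
      rw [det_mul, hK, det_fin_two_of]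
      refine mul_ne_zero hU ?_
      have : 0 < η * ζ := by positivity
      intro h; linarith
    obtain ⟨m, hm⟩ := exists_isFrame_eq hKd
    have hG : A.val * (U * K) =
        (U * K) * !![F 0 0 + σ * η * ζ, 0; 0, F 0 0 - σ * η * ζ] := by
      rw [← Matrix.mul_assoc, h, Matrix.mul_assoc, Matrix.mul_assoc]
      congr 1
      ext i j
      fin_cases i <;> fin_cases j <;>
        simp [hK, Matrix.mul_apply, Fin.sum_univ_two, hy, hz, ← h1] <;> ring
    -- For the scalar product diag(ζ², η²) both the frame of the line and the eigenvectors are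
    -- orthogonal pairs: this is the intersection point.
    obtain ⟨z, c, hc, hg⟩ := exists_gram_eq (m := ζ ^ 2) (n := 0) (k := η ^ 2) (by positivity)
      (by rw [zero_pow two_ne_zero]; positivity) hU
    have hzl : z ∈ l.carrier := by rw [hl.mem_carrier_iff, hg]; simp
    have hzm : z ∈ m.carrier := by
      rw [hm.mem_carrier_iff, gram_mul_apply, hg, hK]
      simp
      ring
    refine ⟨m, ⟨?_, ?_, ?_⟩, z, ?_, ?_⟩
    · rw [G₀.isHyperbolic_mk_iff, ← ht, ← h1]
      rw [← h1] at hd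
      linarith
    · rw [hm.smul_p_iff hG]; simp
    · rw [hm.smul_q_iff hG]; simp
    · rw [hl.orthogonalAt_iff hm hzl hzm, hK]; simp
    · rw [pos z hzl, ← h1]
      have := mul_neg_of_pos_of_neg (gram_pos z hU 0) h2
      have := mul_neg_of_pos_of_neg (gram_pos z hU 1) h3
      linarith

end GeodesicLine

/-! ### Constructing common points of crooked planes -/

/-- A vector `(a, c)` is mapped to `(a', c')`, up to an expanding factor, by an element of the
crooked plane as soon as `|c'| ≤ |c|`. -/
theorem exists_crookedCond_mul_eq {a c a' c' : ℝ} (h0 : a ≠ 0 ∨ c ≠ 0) (h0' : a' ≠ 0 ∨ c' ≠ 0)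
    (h : |c'| ≤ |c|) : ∃ x y z w μ : ℝ, x * w - y * z = 1 ∧ CrookedCond !![x, y; z, w] ∧
      1 ≤ |μ| ∧ x * a + y * c = μ * a' ∧ z * a + w * c = μ * c' := by
  by_cases hc' : c' = 0
  · subst hc'
    replace h0' : a' ≠ 0 := h0'.resolve_right (not_not.2 rfl)
    by_cases hc : c = 0
    · subst hc
      replace h0 : a ≠ 0 := h0.resolve_right (not_not.2 rfl)
      have h1 : 0 < 1 + |a' / a| := by positivity
      -- A diagonal matrix, expanding enough that |μ| = 1 + |a / a'|.
      refine ⟨1 + |a' / a|, 0, 0, (1 + |a' / a|)⁻¹, (1 + |a' / a|) * (a / a'), ?_, ?_, ?_, ?_, ?_⟩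
      · field_simp; ring
      · left
        simp only [Matrix.of_apply, Matrix.cons_val', Matrix.cons_val_zero, Matrix.cons_val_one,
          Matrix.cons_val_fin_one, true_and]
        rw [abs_of_pos h1]
        linarith [abs_nonneg (a' / a)]
      · rw [abs_mul, abs_of_pos h1, abs_div, abs_div]
        have := abs_pos.2 h0
        have := abs_pos.2 h0'
        field_simp
        linarith
      · field_simp; ring
      · ring
    · have h1 : 0 < 1 + |a / a'| := by positivity
      have hne : (1 + |a / a'|) * a' ≠ 0 := mul_ne_zero h1.ne' h0'
      obtain ⟨μ, hμ⟩ : ∃ μ, μ = 1 + |a / a'| := ⟨_, rfl⟩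
      rw [← hμ] at h1 hne
      -- A matrix with equal diagonal entries: they are less than one in absolute value because μ >
      -- |a / a'|, and the off-diagonal entries are forced by the two required equations.
      refine ⟨a / (μ * a'), (μ * a' - a ^ 2 / (μ * a')) / c, -c / (μ * a'), a / (μ * a'), μ,
        ?_, ?_, ?_, ?_, ?_⟩
      · field_simp; ring
      · right; right
        refine ⟨rfl, ?_⟩
        simp only [Matrix.of_apply, Matrix.cons_val', Matrix.cons_val_zero, Matrix.cons_val_fin_one]
        rw [mul_comm, ← div_div, abs_div, abs_of_pos h1, div_lt_one h1, hμ]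
        linarith
      · rw [abs_of_pos h1, hμ]
        linarith [abs_nonneg (a / a')]
      · field_simp; ring
      · field_simp; ring
  · have hc : c ≠ 0 := abs_pos.1 ((abs_pos.2 hc').trans_le h)
    -- An upper triangular matrix, with μ = 1; the second coordinate dictates the diagonal.
    refine ⟨c / c', (a' - c / c' * a) / c, 0, c' / c, 1, ?_, ?_, ?_, ?_, ?_⟩
    · field_simp; ring
    · left
      refine ⟨rfl, ?_⟩
      simp only [Matrix.of_apply, Matrix.cons_val', Matrix.cons_val_zero, Matrix.cons_val_fin_one]
      rw [abs_div, one_le_div (abs_pos.2 hc')]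
      exact h
    · simp
    · field_simp; ring
    · field_simp; ring

theorem exists_crookedCond_mul_col_eq {W W' : Matrix (Fin 2) (Fin 2) ℝ} (h0 : W.det ≠ 0)
    (h0' : W'.det ≠ 0) {i j : Fin 2} (h : |W' i j| ≤ |W i j|) :
    ∃ F : Matrix (Fin 2) (Fin 2) ℝ, ∃ μ : ℝ, F.det = 1 ∧ CrookedCond F ∧ 1 ≤ |μ| ∧
      ∀ k, (F * W) k j = μ * W' k j := by
  have ne : ∀ V : Matrix (Fin 2) (Fin 2) ℝ, V.det ≠ 0 → V 0 j ≠ 0 ∨ V 1 j ≠ 0 := by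
    intro V hV
    by_contra! h
    apply hV
    rw [Matrix.det_fin_two]
    fin_cases j <;> simp_all
  obtain rfl | rfl : i = 0 ∨ i = 1 := by fin_cases i <;> simp
  -- Exchanging the two basis vectors, which preserves `CrookedCond`, reduces row 0 to row 1.
  · obtain ⟨x, y, z, w, μ, h1, h2, h3, h4, h5⟩ :=
      exists_crookedCond_mul_eq (ne W h0).symm (ne W' h0').symm h
    refine ⟨!![w, z; y, x], μ, ?_, ?_, h3, ?_⟩
    · rw [Matrix.det_fin_two_of]; linarith
    · simp only [CrookedCond, Matrix.of_apply, Matrix.cons_val', Matrix.cons_val_zero,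
        Matrix.cons_val_fin_one, Matrix.cons_val_one] at h2 ⊢
      rcases h2 with h2 | h2 | ⟨h2, h2'⟩
      · exact Or.inr (Or.inl h2)
      · exact Or.inl h2
      · exact Or.inr (Or.inr ⟨h2.symm, h2 ▸ h2'⟩)
    · intro k
      fin_cases k <;> simp [Matrix.mul_apply, Fin.sum_univ_two] <;> linarith
  · obtain ⟨x, y, z, w, μ, h1, h2, h3, h4, h5⟩ :=
      exists_crookedCond_mul_eq (ne W h0) (ne W' h0') h
    refine ⟨!![x, y; z, w], μ, ?_, h2, h3, ?_⟩
    · rw [Matrix.det_fin_two_of]; linarith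
    · intro k
      fin_cases k <;> simp [Matrix.mul_apply, Fin.sum_univ_two] <;> linarith

theorem disjoint_smul_smul_iff {G X : Type*} [Group G] [MulAction G X] {g g' : G} {S T : Set X} :
    Disjoint (g • S) (g' • T) ↔ ∀ x ∈ T, (g⁻¹ * g') • x ∉ S := by
  rw [disjoint_comm, Set.disjoint_left]
  constructor
  · intro h x hx hS
    exact h (Set.smul_mem_smul_set hx) (Set.mem_smul_set_iff_inv_smul_mem.2
      (by rwa [← mul_smul]))
  · rintro h _ ⟨x, hx, rfl⟩ hS
    rw [Set.mem_smul_set_iff_inv_smul_mem, ← mul_smul] at hS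
    exact h x hx hS

/-! ### From the geometry to the coordinate matrices W and W' -/

namespace GeodesicLine

open Matrix hiding gram

variable {l l' : GeodesicLine} {U V W W' : Matrix (Fin 2) (Fin 2) ℝ}

theorem TransverseOrientation.exists_isFrame (o : l.TransverseOrientation) {s : ℝ} (hs : s ≠ 0) :
    ∃ U, l.IsFrame U ∧ o.positiveSide = {z | 0 < s * gram z U 0 1} := by
  rcases o.isSide with h | h
  · obtain ⟨U, hU, hg⟩ := l.exists_isFrame (inv_ne_zero hs)
    exact ⟨U, hU, by simp only [h, hg, mul_inv_cancel_left₀ hs]⟩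
  · obtain ⟨U, hU, hg⟩ := l.exists_isFrame (inv_ne_zero (neg_ne_zero.2 hs))
    refine ⟨U, hU, ?_⟩
    rw [h]
    ext z
    have : s * gram z U 0 1 = -l.eqn z := by rw [hg]; field_simp
    simp [this]

theorem IsFrame.exists_transverseOrientation (hl : l.IsFrame U) {s : ℝ} (hs : s ≠ 0) :
    ∃ o : l.TransverseOrientation, o.positiveSide = {z | 0 < s * gram z U 0 1} := by
  obtain ⟨a, b, ha, hb, h1, h2⟩ := hl
  have e (z : ℍ) : s * gram z U 0 1 = s * (a * b) * l.eqn z := by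
    rw [gram_apply, h1, h1, h2, h2, eqn]; ring
  refine ⟨⟨{z | 0 < s * gram z U 0 1}, ?_⟩, rfl⟩
  simp only [e]
  rcases (mul_ne_zero hs (mul_ne_zero ha hb)).lt_or_gt with h | h
  · right; ext z; exact ⟨fun hz => neg_of_mul_pos_right hz h.le, mul_pos_of_neg_of_neg h⟩
  · left; ext z; exact mul_pos_iff_of_pos_left h

/-- If |W' i j| ≤ |W i j|, some F in the crooked plane of ℓ maps column j of W to μ times column j
of W', with |μ| ≥ 1. Then C = W'⁻¹ F W has column j equal to μ times the j-th basis vector, so it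
lies in the crooked plane of ℓ', and F W = W' C is a common point. -/
theorem abs_lt_abs_of_disjoint (hl : l.IsFrame U) (hl' : l'.IsFrame V)
    {H : SpecialLinearGroup (Fin 2) ℝ} (hW : V = U * W) (hW' : H.val * V = U * W')
    (hd : ∀ f ∈ l'.leftCrookedPlane, (H : G₀) • f ∉ l.leftCrookedPlane) (i j : Fin 2) :
    |W i j| < |W' i j| := by
  by_contra! h
  have dV := hl'.det_ne_zero
  have dW : W.det ≠ 0 := fun h0 => dV (by rw [hW, det_mul, h0, mul_zero])
  have dW' : W'.det ≠ 0 := fun h0 => dV (by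
    rw [← one_mul V.det, ← H.2, ← det_mul, hW', det_mul, h0, mul_zero])
  obtain ⟨F, μ, dF, hF, hμ, hFW⟩ := exists_crookedCond_mul_col_eq dW dW' h
  obtain ⟨A, hA⟩ := exists_specialLinearGroup_mul_eq_mul hl.det_ne_zero dF
  obtain ⟨C, hC⟩ := exists_eq_mul dV ((H⁻¹ * A).val * V)
  have dC := det_eq_of_mul_eq_mul dV hC
  rw [(H⁻¹ * A).2] at dC
  refine hd ((H⁻¹ * A : SpecialLinearGroup (Fin 2) ℝ) : G₀) ?_ ?_
  · rw [hl'.mem_leftCrookedPlane_iff hC]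
    have e : F * W = W' * C := by
      refine eq_of_mul_eq_mul_of_det_ne_zero hl.det_ne_zero ?_
      rw [← Matrix.mul_assoc, ← Matrix.mul_assoc, ← hA, ← hW', Matrix.mul_assoc, ← hW,
        Matrix.mul_assoc, ← hC, ← Matrix.mul_assoc]
      exact congrArg (· * V) (congrArg Subtype.val (mul_inv_cancel_left H A).symm)
    have e0 : W' 0 0 * C 0 j + W' 0 1 * C 1 j = μ * W' 0 j := by
      rw [← hFW, e]; simp [Matrix.mul_apply, Fin.sum_univ_two]
    have e1 : W' 1 0 * C 0 j + W' 1 1 * C 1 j = μ * W' 1 j := by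
      rw [← hFW, e]; simp [Matrix.mul_apply, Fin.sum_univ_two]
    rw [det_fin_two] at dW'
    obtain rfl | rfl : j = 0 ∨ j = 1 := by fin_cases j <;> simp
    · left
      have c1 : C 1 0 = 0 := mul_left_cancel₀ dW' (by linear_combination W' 0 0 * e1 - W' 1 0 * e0)
      have c2 : C 0 0 = μ := mul_left_cancel₀ dW' (by linear_combination W' 1 1 * e0 - W' 0 1 * e1)
      exact ⟨c1, c2 ▸ hμ⟩
    · right; left
      have c1 : C 0 1 = 0 := mul_left_cancel₀ dW' (by linear_combination W' 1 1 * e0 - W' 0 1 * e1)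
      have c2 : C 1 1 = μ := mul_left_cancel₀ dW' (by linear_combination W' 0 0 * e1 - W' 1 0 * e0)
      exact ⟨c1, c2 ▸ hμ⟩
  · rw [smul_eq_mul, ← QuotientGroup.mk_mul, mul_inv_cancel_left, hl.mem_leftCrookedPlane_iff hA]
    exact hF

theorem exists_gram_smul_frame {H : SpecialLinearGroup (Fin 2) ℝ} (hW' : H.val * V = U * W')
    (y : ℍ) : ∃ k : ℝ, 0 < k ∧ k * gram y V 0 1 = gram (H • y) U 0 0 * (W' 0 0 * W' 0 1) +
      gram (H • y) U 0 1 * (W' 0 0 * W' 1 1 + W' 1 0 * W' 0 1) +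
      gram (H • y) U 1 1 * (W' 1 0 * W' 1 1) := by
  obtain ⟨k, hk, hg⟩ := exists_gram_smul H y
  refine ⟨k, hk, ?_⟩
  rw [← gram_mul_apply, ← hW', hg, Matrix.smul_apply, smul_eq_mul]

/-- The opposite signs 1 and -1 in the two orientations are what makes disjointness say that a
scalar product positive on the pair U is never negative on the pair U W'. -/
theorem same_sign_of_disjoint_positiveSide (hl : l.IsFrame U) (hl' : l'.IsFrame V)
    {H : SpecialLinearGroup (Fin 2) ℝ} (hW' : H.val * V = U * W')
    {o : l.TransverseOrientation} {o' : l'.TransverseOrientation}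
    (ho : o.positiveSide = {z | 0 < 1 * gram z U 0 1})
    (ho' : o'.positiveSide = {z | 0 < -1 * gram z V 0 1})
    (hd : ∀ z ∈ o'.positiveSide, (H : G₀) • z ∉ o.positiveSide) :
    (∀ i j, 0 ≤ W' i j) ∨ ∀ i j, W' i j ≤ 0 := by
  have dW' : W'.det ≠ 0 := fun h0 => hl'.det_ne_zero (by
    rw [← one_mul V.det, ← H.2, ← det_mul, hW', det_mul, h0, mul_zero])
  refine same_sign_of_forall dW' fun A C hA hC hAC => ?_
  obtain ⟨z, c, hc, hg⟩ := exists_gram_eq (m := A) (n := 1) (k := C) hA (by simpa) hl.det_ne_zero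
  obtain ⟨k, hk, e⟩ := exists_gram_smul_frame hW' (H⁻¹ • z)
  rw [smul_inv_smul, hg] at e
  have h := hd (H⁻¹ • z)
  rw [ho, ho', G₀.mk_smul, smul_inv_smul] at h
  simp only [Set.mem_ofPred_eq, hg] at h
  simp at h e
  have h1 := not_lt.1 (h.mt (not_le.2 hc))
  have h2 : 0 ≤ c * (W' 0 0 * W' 0 1 * A + (W' 0 0 * W' 1 1 + W' 0 1 * W' 1 0) +
      W' 1 0 * W' 1 1 * C) := by
    have := mul_nonneg hk.le h1
    linarith
  exact nonneg_of_mul_nonneg_right h2 hc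

/-- The product of the vectors of H V is g₀ P + g₀₁ T + g₁ Q, where g₀, g₁ > 0 and P, Q have the
same sign. The orientations are chosen so that the three terms have the sign of P on the positive
side of ℓ. -/
theorem exists_positiveSide_disjoint (hl : l.IsFrame U) (hl' : l'.IsFrame V)
    {H : SpecialLinearGroup (Fin 2) ℝ} (hW' : H.val * V = U * W')
    (hpos : 0 < W' 0 0 * W' 1 1 * (W' 0 1 * W' 1 0)) :
    ∃ (o : l.TransverseOrientation) (o' : l'.TransverseOrientation),
      ∀ z ∈ o'.positiveSide, (H : G₀) • z ∉ o.positiveSide := by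
  obtain ⟨P, hP⟩ : ∃ P, P = W' 0 0 * W' 0 1 := ⟨_, rfl⟩
  obtain ⟨Q, hQ⟩ : ∃ Q, Q = W' 1 0 * W' 1 1 := ⟨_, rfl⟩
  obtain ⟨T, hT⟩ : ∃ T, T = W' 0 0 * W' 1 1 + W' 1 0 * W' 0 1 := ⟨_, rfl⟩
  have hPQ : 0 < P * Q := by rw [hP, hQ]; linarith
  have hP0 : P ≠ 0 := left_ne_zero_of_mul hPQ.ne'
  have hT0 : T ≠ 0 := by
    rintro rfl
    have h1 : W' 0 0 * W' 1 1 = -(W' 0 1 * W' 1 0) := by linarith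
    rw [h1] at hpos
    nlinarith [sq_nonneg (W' 0 1 * W' 1 0)]
  obtain ⟨o, ho⟩ := hl.exists_transverseOrientation (mul_ne_zero hP0 hT0)
  obtain ⟨o', ho'⟩ := hl'.exists_transverseOrientation (neg_ne_zero.2 hP0)
  refine ⟨o, o', fun z hz hHz => ?_⟩
  rw [ho', Set.mem_ofPred_eq] at hz
  rw [ho, Set.mem_ofPred_eq, G₀.mk_smul] at hHz
  obtain ⟨k, hk, e⟩ := exists_gram_smul_frame hW' z
  rw [← hP, ← hQ, ← hT] at e
  have h1 := mul_pos hk hz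
  have g0 := mul_pos (gram_pos (H • z) hl.det_ne_zero 0) (mul_self_pos.2 hP0)
  have g1 := mul_pos (gram_pos (H • z) hl.det_ne_zero 1) hPQ
  have h2 : k * (-P * gram z V 0 1) = -(gram (H • z) U 0 0 * (P * P)) -
      P * T * gram (H • z) U 0 1 - gram (H • z) U 1 1 * (P * Q) := by
    linear_combination -P * e
  linarith

theorem carrier_disjoint (hl : l.IsFrame U) (hl' : l'.IsFrame V)
    {H : SpecialLinearGroup (Fin 2) ℝ} (hW' : H.val * V = U * W')
    (hpos : 0 < W' 0 0 * W' 1 1 * (W' 0 1 * W' 1 0)) :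
    ∀ z ∈ l'.carrier, (H : G₀) • z ∉ l.carrier := by
  intro z hz hHz
  rw [hl'.mem_carrier_iff] at hz
  rw [G₀.mk_smul, hl.mem_carrier_iff] at hHz
  obtain ⟨k, hk, e⟩ := exists_gram_smul_frame hW' z
  rw [hz, hHz] at e
  have hPQ : 0 < (W' 0 0 * W' 0 1) * (W' 1 0 * W' 1 1) := by linarith
  have g0 := gram_pos (H • z) hl.det_ne_zero 0
  have g1 := gram_pos (H • z) hl.det_ne_zero 1
  rcases mul_pos_iff.1 hPQ with ⟨h1, h2⟩ | ⟨h1, h2⟩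
  · have := mul_pos g0 h1
    have := mul_pos g1 h2
    linarith
  · have := mul_neg_of_pos_of_neg g0 h1
    have := mul_neg_of_pos_of_neg g1 h2
    linarith

/-- From W' = P W Q, the element acting by P⁻¹ in U and the one acting by Q in V are the required A
and B with A H = B. The signs 1 and -1 compensate for the inversion of P. -/
theorem mem_inv_mul_of_abs_lt_abs (hl : l.IsFrame U) (hl' : l'.IsFrame V)
    {H : SpecialLinearGroup (Fin 2) ℝ} (hW : V = U * W) (hW' : H.val * V = U * W')
    {o : l.TransverseOrientation} {o' : l'.TransverseOrientation}
    (ho : o.positiveSide = {z | 0 < 1 * gram z U 0 1})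
    (ho' : o'.positiveSide = {z | 0 < -1 * gram z V 0 1})
    (hlt : ∀ i j, |W i j| < |W' i j|) (hs : (∀ i j, 0 ≤ W' i j) ∨ ∀ i j, W' i j ≤ 0) :
    (H : G₀) ∈ (l.stemQuadrant o)⁻¹ * l'.stemQuadrant o' := by
  have dU := hl.det_ne_zero
  have dV := hl'.det_ne_zero
  have dW : W.det ≠ 0 := fun h0 => dV (by rw [hW, det_mul, h0, mul_zero])
  have hd : W.det = W'.det := by
    refine mul_left_cancel₀ dU ?_
    rw [← det_mul, ← det_mul, ← hW, ← hW', det_mul, H.2, one_mul]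
  have ne (i j : Fin 2) : W' i j ≠ 0 := abs_pos.1 ((abs_nonneg _).trans_lt (hlt i j))
  obtain ⟨P, Q, dP, dQ, ⟨P1, P2, P3⟩, ⟨Q1, Q2, Q3⟩, e⟩ : ∃ P Q : Matrix (Fin 2) (Fin 2) ℝ,
      P.det = 1 ∧ Q.det = 1 ∧ StemQuadrantCond P ∧ StemQuadrantCond Q ∧ W' = P * W * Q := by
    rcases hs with hs | hs
    · exact exists_stemQuadrantCond_factorization hd dW hlt
        fun i j => (hs i j).lt_of_ne' (ne i j)
    · obtain ⟨P, Q, h1, h2, h3, h4, h5⟩ := exists_stemQuadrantCond_factorization (W := -W)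
        (W' := -W') (by simpa [det_fin_two] using hd) (by simpa [det_fin_two] using dW)
        (by simpa using hlt) fun i j => neg_pos.2 ((hs i j).lt_of_ne (ne i j))
      exact ⟨P, Q, h1, h2, h3, h4, by simpa using h5⟩
  have dP' : (!![P 1 1, -P 0 1; -P 1 0, P 0 0]).det = 1 := by
    rw [det_fin_two] at dP
    rw [det_fin_two_of]; linarith
  have hP : P * !![P 1 1, -P 0 1; -P 1 0, P 0 0] = 1 := by
    rw [det_fin_two] at dP
    ext i j
    fin_cases i <;> fin_cases j <;> simp [Matrix.mul_apply, Fin.sum_univ_two] <;> linarith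
  obtain ⟨A, hA⟩ := exists_specialLinearGroup_mul_eq_mul dU dP'
  obtain ⟨B, hB⟩ := exists_specialLinearGroup_mul_eq_mul dV dQ
  have hAB : A * H = B := by
    have h1 : (A * H).val * V = B.val * V := by
      have h2 : A.val * (U * P) = U := by
        rw [← Matrix.mul_assoc, hA, Matrix.mul_assoc, mul_eq_one_comm.1 hP, Matrix.mul_one]
      have h3 : (A * H).val * V = A.val * (H.val * V) := Matrix.mul_assoc _ _ _
      rw [h3, hW', hB, e, hW, Matrix.mul_assoc P, ← Matrix.mul_assoc U P, ← Matrix.mul_assoc A.val,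
        h2, Matrix.mul_assoc]
    refine Subtype.ext ?_
    have hv : IsUnit V.det := isUnit_iff_ne_zero.2 dV
    rw [← mul_nonsing_inv_cancel_right V (A * H).val hv, h1, mul_nonsing_inv_cancel_right V _ hv]
  rw [Set.mem_mul]
  refine ⟨((A : G₀))⁻¹, ?_, (B : G₀), ?_, ?_⟩
  · rw [Set.inv_mem_inv, hl.mem_stemQuadrant_iff ho hA]
    simp
    rw [← P1]
    exact ⟨rfl, P2, P3⟩
  · rw [hl'.mem_stemQuadrant_iff ho' hB]
    exact ⟨Q1, by linarith, by linarith⟩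
  · rw [← hAB, QuotientGroup.mk_mul, inv_mul_cancel_left]

theorem abs_lt_abs_of_mem_inv_mul (hl : l.IsFrame U) (hl' : l'.IsFrame V)
    {H : SpecialLinearGroup (Fin 2) ℝ} (hW : V = U * W) (hW' : H.val * V = U * W')
    {o : l.TransverseOrientation} {o' : l'.TransverseOrientation}
    (ho : o.positiveSide = {z | 0 < 1 * gram z U 0 1})
    (ho' : o'.positiveSide = {z | 0 < -1 * gram z V 0 1})
    (hs : (∀ i j, 0 ≤ W i j) ∨ ∀ i j, W i j ≤ 0)
    (hH : (H : G₀) ∈ (l.stemQuadrant o)⁻¹ * l'.stemQuadrant o') (i j : Fin 2) :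
    |W i j| < |W' i j| := by
  have dU := hl.det_ne_zero
  have dV := hl'.det_ne_zero
  have dW : W.det ≠ 0 := fun h0 => dV (by rw [hW, det_mul, h0, mul_zero])
  obtain ⟨a, ha, b, hb, hab⟩ := Set.mem_mul.1 hH
  obtain ⟨B, rfl⟩ := QuotientGroup.mk_surjective b
  have haH : a⁻¹ = ((B * H⁻¹ : SpecialLinearGroup (Fin 2) ℝ) : G₀) := by
    rw [QuotientGroup.mk_mul, QuotientGroup.mk_inv, ← hab, _root_.mul_inv_rev,
      mul_inv_cancel_left]
  rw [Set.mem_inv, haH] at ha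
  obtain ⟨A, hAB⟩ : ∃ A, A = B * H⁻¹ := ⟨_, rfl⟩
  rw [← hAB] at ha
  obtain ⟨F, hF⟩ := exists_eq_mul dU (A.val * U)
  obtain ⟨G, hG⟩ := exists_eq_mul dV (B.val * V)
  rw [hl.mem_stemQuadrant_iff ho hF] at ha
  rw [hl'.mem_stemQuadrant_iff ho' hG] at hb
  have dF := det_eq_of_mul_eq_mul dU hF
  have dG := det_eq_of_mul_eq_mul dV hG
  rw [A.2] at dF
  rw [B.2] at dG
  obtain ⟨P, hP⟩ : ∃ P, P = !![F 1 1, -F 0 1; -F 1 0, F 0 0] := ⟨_, rfl⟩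
  have hPF : P * F = 1 := by
    rw [det_fin_two] at dF
    ext i j
    fin_cases i <;> fin_cases j <;> simp [hP, Matrix.mul_apply, Fin.sum_univ_two] <;> linarith
  have dP : P.det = 1 := by
    have := congrArg Matrix.det hPF
    rwa [det_mul, dF, mul_one, det_one] at this
  have e : W' = P * W * G := by
    have h1 : F * W' = W * G := by
      refine eq_of_mul_eq_mul_of_det_ne_zero dU ?_
      rw [← Matrix.mul_assoc, ← Matrix.mul_assoc, ← hF, Matrix.mul_assoc, ← hW', ← hW, ← hG,
        ← Matrix.mul_assoc]
      exact congrArg (· * V) (congrArg Subtype.val (mul_inv_eq_iff_eq_mul.1 hAB.symm).symm)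
    rw [Matrix.mul_assoc, ← h1, ← Matrix.mul_assoc, hPF, Matrix.one_mul]
  rw [e]
  refine abs_lt_abs_of_stemQuadrantCond ?_ ?_ dP dG dW hs i j
  · rw [hP]
    simp only [StemQuadrantCond, of_apply, cons_val', cons_val_zero, cons_val_fin_one, cons_val_one]
    exact ⟨ha.1.symm, by rw [← ha.1]; linarith [ha.2.1], by rw [← ha.1]; linarith [ha.2.2]⟩
  · exact ⟨hb.1, by linarith [hb.2.1], by linarith [hb.2.2]⟩

theorem leftCrookedPlane_disjoint (hl : l.IsFrame U) (hl' : l'.IsFrame V)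
    {H : SpecialLinearGroup (Fin 2) ℝ} (hW : V = U * W) (hW' : H.val * V = U * W')
    (hlt : ∀ i j, |W i j| < |W' i j|) :
    ∀ f ∈ l'.leftCrookedPlane, (H : G₀) • f ∉ l.leftCrookedPlane := by
  intro f hf hHf
  obtain ⟨C, rfl⟩ := QuotientGroup.mk_surjective f
  obtain ⟨G, hG⟩ := exists_eq_mul hl'.det_ne_zero (C.val * V)
  obtain ⟨F, hF⟩ := exists_eq_mul hl.det_ne_zero ((H * C).val * U)
  rw [smul_eq_mul, ← QuotientGroup.mk_mul, hl.mem_leftCrookedPlane_iff hF] at hHf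
  rw [hl'.mem_leftCrookedPlane_iff hG] at hf
  refine hHf.mul_ne_mul hf ?_ ?_ hlt ?_
  · rw [det_eq_of_mul_eq_mul hl.det_ne_zero hF, (H * C).2]
  · rw [det_eq_of_mul_eq_mul hl'.det_ne_zero hG, C.2]
  · refine eq_of_mul_eq_mul_of_det_ne_zero hl.det_ne_zero ?_
    rw [← Matrix.mul_assoc, ← Matrix.mul_assoc, ← hF, Matrix.mul_assoc, ← hW, ← hW',
      Matrix.mul_assoc, ← hG, ← Matrix.mul_assoc]
    rfl

end GeodesicLine

/-! ### The theorem -/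

theorem theoremB1 (l l' : GeodesicLine) (g g' : G₀) :
    (Disjoint (g • l.leftCrookedPlane) (g' • l'.leftCrookedPlane) →
      Disjoint (g • l.carrier) (g' • l'.carrier) ∧
      (∃ (o : l.TransverseOrientation) (o' : l'.TransverseOrientation),
        DisjointAndOrientedAway g g' l l' o o') ∧
      ∀ (o : l.TransverseOrientation) (o' : l'.TransverseOrientation),
        DisjointAndOrientedAway g g' l l' o o' →
        g⁻¹ * g' ∈ (l.stemQuadrant o)⁻¹ * l'.stemQuadrant o') ∧
    (∀ (o : l.TransverseOrientation) (o' : l'.TransverseOrientation),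
      DisjointAndOrientedAway 1 1 l l' o o' →
      DisjointAndOrientedAway g g' l l' o o' →
      g⁻¹ * g' ∈ (l.stemQuadrant o)⁻¹ * l'.stemQuadrant o' →
      Disjoint (g • l.leftCrookedPlane) (g' • l'.leftCrookedPlane)) := by
  simp only [DisjointAndOrientedAway, disjoint_smul_smul_iff]
  obtain ⟨H, hH⟩ := QuotientGroup.mk_surjective (g⁻¹ * g')
  rw [← hH]
  refine ⟨fun hd => ?_, fun o o' h1 _ hm => ?_⟩
  · obtain ⟨U, hU, -⟩ := l.exists_isFrame one_ne_zero
    obtain ⟨V, hV, -⟩ := l'.exists_isFrame one_ne_zero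
    obtain ⟨W, hW⟩ := exists_eq_mul hU.det_ne_zero V
    obtain ⟨W', hW'⟩ := exists_eq_mul hU.det_ne_zero (H.val * V)
    have hdet : W.det = W'.det := by
      refine mul_left_cancel₀ hU.det_ne_zero ?_
      rw [← Matrix.det_mul, ← Matrix.det_mul, ← hW, ← hW', Matrix.det_mul, H.2, one_mul]
    have hpos := mul_pos_of_abs_lt_abs hdet (GeodesicLine.abs_lt_abs_of_disjoint hU hV hW hW' hd)
    have hc := GeodesicLine.carrier_disjoint hU hV hW' hpos
    obtain ⟨o, o', ho⟩ := GeodesicLine.exists_positiveSide_disjoint hU hV hW' hpos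
    refine ⟨hc, ⟨o, o', hc, ho⟩, fun o o' ⟨_, ho⟩ => ?_⟩
    -- The frames above were arbitrary; new ones are adapted to the given orientations, and the
    -- entrywise criterion holds for them too.
    obtain ⟨U, hU, hoU⟩ := o.exists_isFrame one_ne_zero
    obtain ⟨V, hV, hoV⟩ := o'.exists_isFrame (neg_ne_zero.2 one_ne_zero)
    obtain ⟨W, hW⟩ := exists_eq_mul hU.det_ne_zero V
    obtain ⟨W', hW'⟩ := exists_eq_mul hU.det_ne_zero (H.val * V)
    exact GeodesicLine.mem_inv_mul_of_abs_lt_abs hU hV hW hW' hoU hoV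
      (GeodesicLine.abs_lt_abs_of_disjoint hU hV hW hW' hd)
      (GeodesicLine.same_sign_of_disjoint_positiveSide hU hV hW' hoU hoV ho)
  · obtain ⟨U, hU, hoU⟩ := o.exists_isFrame one_ne_zero
    obtain ⟨V, hV, hoV⟩ := o'.exists_isFrame (neg_ne_zero.2 one_ne_zero)
    obtain ⟨W, hW⟩ := exists_eq_mul hU.det_ne_zero V
    obtain ⟨W', hW'⟩ := exists_eq_mul hU.det_ne_zero (H.val * V)
    refine GeodesicLine.leftCrookedPlane_disjoint hU hV hW hW'
      (GeodesicLine.abs_lt_abs_of_mem_inv_mul hU hV hW hW' hoU hoV ?_ hm)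
    -- Here W plays the role of W' for the identity: this is where ℓ and ℓ' themselves being
    -- oriented away from each other is used.
    refine GeodesicLine.same_sign_of_disjoint_positiveSide (H := 1) hU hV ?_ hoU hoV ?_
    · rw [← hW]; exact Matrix.one_mul V
    · have h2 := h1.2
      rw [inv_one, one_mul] at h2
      exact h2
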